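/- Let $n\ge 2$, and let $J(n,2)$ be the Johnson graph, whose vertices are the $2$-element subsets of $[n]=\{1,\dots,n\}$, two of them being adjacent iff they share exactly one element. A family of binary observables on $\mathbb{C}^d$ ($d\ge 1$) is a finite family $(A_v)_{v\in V}$ of Hermitian $d\times d$ matrices with $A_v^2=\mathbb{1}$. A graph $G$ on $V$ is its anti-commutativity graph if, for all $v,w\in V$, $v$ and $w$ are adjacent iff $A_vA_w=-A_wA_v$, while $A_vA_w=A_wA_v$ whenever $v,w$ are not adjacent. For $\eta\in[0,1]$ put $A_v^\eta=\eta A_v+\frac{\operatorname{tr}A_v}{d}(1-\eta)\mathbb{1}$ and $M_v^\eta(\pm)=\frac12(\mathbb{1}\pm A_v^\eta)$. The noisy family is jointly measurable if there are positive semidefinite matrices $E(a)$, $a\in\{\pm1\}^V$, with $\sum_a E(a)=\mathbb{1}$ and $M_v^\eta(\pm)=\sum_{a:\,a_v=\pm1}E(a)$ for all $v$. The incompatibility robustness is the largest $\eta\in[0,1]$ for which the noisy family is jointly measurable. Majorana operators $\Gamma_1,\dots,\Gamma_n$ on $\mathbb{C}^d$ are Hermitian $d\times d$ matrices with $\Gamma_j\Gamma_k+\Gamma_k\Gamma_j=2\delta_{jk}\mathbb{1}$;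 they exist for some $d\ge1$. For all such operators, with $d\ge 1$, the quadratic Majorana observables $i\Gamma_u\Gamma_v$, $1\le u<v\le n$, form a family of binary observables with anti-commutativity graph $J(n,2)$. For every family of binary observables on $\mathbb{C}^d$, $d\ge 1$, with anti-commutativity graph $J(n,2)$ (in particular the quadratic Majorana observables), the incompatibility robustness $\eta$ exists (the maximum is attained) and satisfies $$\eta\;\le\;\frac{1}{\sqrt{n-1}},$$ with equality if and only if there is a skew-conference matrix of order $n$, that is, a real $n\times n$ matrix $C$ with zero diagonal, off-diagonal entries $\pm1$, $C^\top=-C$ and $CC^\top=(n-1)\mathbb{1}$. -/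

import Mathlib

open scoped ComplexOrder Matrix

/-- A family of binary observables on `ℂ^d`: Hermitian matrices that square to the identity. -/
def IsBinaryObservableFamily {V : Type*} {d : ℕ} (A : V → Matrix (Fin d) (Fin d) ℂ) : Prop :=
  ∀ v, (A v).IsHermitian ∧ A v * A v = 1

/-- `G` is the anti-commutativity graph of the family `A`: adjacent vertices are exactly the
anti-commuting pairs, and non-adjacent vertices correspond to commuting observables. -/
def IsAnticommutativityGraph {V : Type*} {d : ℕ} (G : SimpleGraph V)
    (A : V → Matrix (Fin d) (Fin d) ℂ) : Prop :=
  (∀ v w, G.Adj v w ↔ A v * A w = -(A w * A v)) ∧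
    ∀ v w, ¬ G.Adj v w → A v * A w = A w * A v

/-- A positive operator-valued measure on `ℂ^d` with finite outcome set `Ω`. -/
def IsPOVM {Ω : Type*} [Fintype Ω] {d : ℕ} (E : Ω → Matrix (Fin d) (Fin d) ℂ) : Prop :=
  (∀ a, (E a).PosSemidef) ∧ ∑ a, E a = 1

/-- Joint measurability of a family of two-outcome measurements `M v`, with outcomes `±1`
(the units of `ℤ`): each `M v` is the marginal, at coordinate `v`, of one parent POVM whose
outcomes are the sign vectors `a ∈ {±1}^V`. -/
def JointlyMeasurable {V : Type*} [Fintype V] [DecidableEq V] {d : ℕ}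
    (M : V → ℤˣ → Matrix (Fin d) (Fin d) ℂ) : Prop :=
  ∃ E : (V → ℤˣ) → Matrix (Fin d) (Fin d) ℂ, IsPOVM E ∧
    ∀ v s, M v s = ∑ a with a v = s, E a

/-- The noisy version `η A + (tr A / d) (1 - η) 1` of an observable `A` on `ℂ^d`. -/
noncomputable def noisyObservable {d : ℕ} (η : ℝ) (A : Matrix (Fin d) (Fin d) ℂ) :
    Matrix (Fin d) (Fin d) ℂ :=
  (η : ℂ) • A + (A.trace / (d : ℂ) * (1 - (η : ℂ))) • (1 : Matrix (Fin d) (Fin d) ℂ)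

/-- The effects `(1 ± B) / 2` of the two-outcome measurement associated with `B`. -/
noncomputable def binaryEffect {d : ℕ} (B : Matrix (Fin d) (Fin d) ℂ) (s : ℤˣ) :
    Matrix (Fin d) (Fin d) ℂ :=
  (1 / 2 : ℂ) • (1 + ((s : ℤ) : ℂ) • B)

/-- The noise parameters `η ∈ [0, 1]` at which the noisy versions of the observables `A v`
are jointly measurable. -/
def jointMeasurabilitySet {V : Type*} [Fintype V] [DecidableEq V] {d : ℕ}
    (A : V → Matrix (Fin d) (Fin d) ℂ) : Set ℝ :=
  {η | η ∈ Set.Icc (0 : ℝ) 1 ∧ JointlyMeasurable fun v => binaryEffect (noisyObservable η (A v))}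

/-- The incompatibility robustness of a family of observables. -/
noncomputable def incompatibilityRobustness {V : Type*} [Fintype V] [DecidableEq V] {d : ℕ}
    (A : V → Matrix (Fin d) (Fin d) ℂ) : ℝ :=
  sSup (jointMeasurabilitySet A)

/-- The Johnson graph `J(n, k)`: vertices are the `k`-element subsets of an `n`-element set,
two of them being adjacent when they have exactly `k - 1` common elements. -/
def johnsonGraph (n k : ℕ) : SimpleGraph {s : Finset (Fin n) // s.card = k} where
  Adj s t := (s.1 ∩ t.1).card + 1 = k
  symm := ⟨fun s t h => by rwa [Finset.inter_comm]⟩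
  loopless := ⟨fun s h => by
    have hs := s.2
    rw [Finset.inter_self] at h
    omega⟩

/-- Majorana operators on `ℂ^d`: Hermitian, squaring to the identity, pairwise
anti-commuting. -/
def IsMajoranaFamily {n d : ℕ} (Γ : Fin n → Matrix (Fin d) (Fin d) ℂ) : Prop :=
  (∀ j, (Γ j).IsHermitian) ∧ (∀ j, Γ j * Γ j = 1) ∧
    ∀ j k, j ≠ k → Γ j * Γ k + Γ k * Γ j = 0

theorem nonempty_of_card_two {n : ℕ} (e : {s : Finset (Fin n) // s.card = 2}) :
    e.1.Nonempty :=
  Finset.card_pos.mp (by rw [e.2]; norm_num)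

/-- The quadratic Majorana observables `i Γ_u Γ_v`, `u < v`, indexed by the two-element sets
`{u, v}`. -/
noncomputable def quadraticMajorana {n d : ℕ} (Γ : Fin n → Matrix (Fin d) (Fin d) ℂ)
    (e : {s : Finset (Fin n) // s.card = 2}) : Matrix (Fin d) (Fin d) ℂ :=
  Complex.I • (Γ (e.1.min' (nonempty_of_card_two e)) * Γ (e.1.max' (nonempty_of_card_two e)))

/-- A skew-conference matrix of order `n`: zero diagonal, off-diagonal entries `±1`,
`C Cᵀ = (n - 1) 1`, and `Cᵀ = -C`. -/
def IsSkewConferenceMatrix {n : ℕ} (C : Matrix (Fin n) (Fin n) ℝ) : Prop :=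
  (∀ i, C i i = 0) ∧ (∀ i j, i ≠ j → C i j = 1 ∨ C i j = -1) ∧
    C * Cᵀ = ((n : ℝ) - 1) • (1 : Matrix (Fin n) (Fin n) ℝ) ∧ Cᵀ = -C

/-! Upper bound: the pairs through a fixed point index `n - 1` pairwise anti-commuting observables,
so any signed sum `S` of them satisfies `S² = n - 1`, hence `S ≤ √(n - 1)`. Pairing each parent
effect `E a` with the sum signed by `a` and taking traces gives `η (n - 1) ≤ √(n - 1)`
(`le_one_div_sqrt_card_of_clique`).

Equality case: tightness makes every `E a` an eigen-operator of the signed sum of every star, and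
the anti-commutator of `A v` with that sum then fixes the expectation of `A v`: a normalised nonzero
column of some `E a` is a state in which all expectations are `± 1 / √(n - 1)`
(`exists_state_of_tight`). Conversely, if `A'` has the commutation pattern of `A`, the operators `A
v ⊗ A' v` commute, and compressing their joint measurement by a state of `A'` with expectations `±
η` gives a parent for `η A` (`exists_povm_of_state`). So attaining the bound depends only on the
graph and may be tested on Majorana operators.

There the question concerns covariance matrices. The Gram matrix `K` of the vectors `Γ j ψ` is `1 -
i C / √(n - 1)` with `C` a skew sign matrix; `Kᵀ K` has trace zero, and positivity forces `C² = -(n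
- 1)` (`exists_skewConference_of_state`). Conversely, a skew-conference matrix rescales to an
orthogonal complex structure, which is the covariance of a fermionic vacuum
(`exists_state_of_skewConference`). The maximum exists by compactness. -/

/-! ### Parent measurements in terms of signed sums -/

section Marginals

variable {V : Type*} [Fintype V] [DecidableEq V]

/-- For signs, the indicator of `a v = s` is `(1 + s * a v) / 2`. -/
theorem sum_filter_units_eq {M : Type*} [AddCommGroup M] [Module ℂ M] (E : (V → ℤˣ) → M)
    (v : V) (s : ℤˣ) :
    ∑ a with a v = s, E a =
      (1 / 2 : ℂ) • (∑ a, E a + ((s : ℤ) : ℂ) • ∑ a, ((a v : ℤ) : ℂ) • E a) := by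
  rw [Finset.sum_filter, Finset.smul_sum, ← Finset.sum_add_distrib, Finset.smul_sum]
  refine Finset.sum_congr rfl fun a _ => ?_
  rcases Int.units_eq_one_or (a v) with h | h <;> rcases Int.units_eq_one_or s with h' | h' <;>
    simp [h, h', ← two_smul ℂ (E a), smul_smul]

theorem jointlyMeasurable_binaryEffect_iff {d : ℕ} (B : V → Matrix (Fin d) (Fin d) ℂ) :
    JointlyMeasurable (fun v => binaryEffect (B v)) ↔
      ∃ E : (V → ℤˣ) → Matrix (Fin d) (Fin d) ℂ, IsPOVM E ∧
        ∀ v, ∑ a, ((a v : ℤ) : ℂ) • E a = B v := by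
  refine exists_congr fun E => and_congr_right fun hE => forall_congr' fun v => ?_
  constructor
  · intro h
    have := h 1
    rw [sum_filter_units_eq, hE.2] at this
    simpa [binaryEffect] using this.symm
  · intro h s
    rw [sum_filter_units_eq, hE.2, h]
    rfl

end Marginals

/-! ### Joint spectral projections of commuting involutions -/

section JointProjections

variable {V : Type*} [Fintype V]

/-- Expanding `∏ v, ((1 + B v) / 2 + (1 - B v) / 2)`, each of whose factors is `1`, produces exactly
this sum. -/
theorem sum_prod_half_one_add [DecidableEq V] {R : Type*} [CommRing R] [Algebra ℂ R] (B : V → R) :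
    ∑ a : V → ℤˣ, ∏ v, (1 / 2 : ℂ) • (1 + ((a v : ℤ) : ℂ) • B v) = 1 := by
  have h := Finset.prod_univ_sum (fun _ : V => (Finset.univ : Finset ℤˣ))
    (fun v s => (1 / 2 : ℂ) • (1 + ((s : ℤ) : ℂ) • B v))
  rw [Fintype.piFinset_univ] at h
  rw [← h]
  refine Finset.prod_eq_one fun v _ => ?_
  have hu : (Finset.univ : Finset ℤˣ) = {1, -1} := rfl
  rw [hu, Finset.sum_pair (by decide), ← smul_add]
  simp only [Units.val_one, Int.cast_one, one_smul, Units.val_neg, Int.cast_neg, neg_smul]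
  rw [show (1 + B v + (1 + -B v) : R) = (2 : ℂ) • (1 : R) by
    rw [two_smul]; ring, smul_smul]
  norm_num

theorem mul_prod_half_one_add [DecidableEq V] {R : Type*} [CommRing R] [Algebra ℂ R] (B : V → R)
    (hB : ∀ v, B v * B v = 1) (a : V → ℤˣ) (w : V) :
    B w * ∏ v, (1 / 2 : ℂ) • (1 + ((a v : ℤ) : ℂ) • B v) =
      ((a w : ℤ) : ℂ) • ∏ v, (1 / 2 : ℂ) • (1 + ((a v : ℤ) : ℂ) • B v) := by
  rw [← Finset.mul_prod_erase _ _ (Finset.mem_univ w), ← mul_assoc, ← smul_mul_assoc]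
  congr 1
  rcases Int.units_eq_one_or (a w) with h | h <;>
    simp [h, mul_add, hB, add_comm]

theorem prod_half_one_add_mul_self {R : Type*} [CommRing R] [Algebra ℂ R] (B : V → R)
    (hB : ∀ v, B v * B v = 1) (a : V → ℤˣ) :
    (∏ v, (1 / 2 : ℂ) • (1 + ((a v : ℤ) : ℂ) • B v)) *
      (∏ v, (1 / 2 : ℂ) • (1 + ((a v : ℤ) : ℂ) • B v)) =
      ∏ v, (1 / 2 : ℂ) • (1 + ((a v : ℤ) : ℂ) • B v) := by
  rw [← Finset.prod_mul_distrib]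
  refine Finset.prod_congr rfl fun v _ => ?_
  have h2 : B v * B v = 1 := hB v
  rw [smul_mul_smul_comm]
  have : (1 + ((a v : ℤ) : ℂ) • B v) * (1 + ((a v : ℤ) : ℂ) • B v) =
      (2 : ℂ) • (1 + ((a v : ℤ) : ℂ) • B v) := by
    rw [two_smul]
    rcases Int.units_eq_one_or (a v) with h | h <;> simp [h] <;> linear_combination h2
  rw [this, smul_smul]
  norm_num

open scoped IsMulCommutative in
/-- Commuting Hermitian involutions have a joint projective measurement. -/
theorem exists_joint_projections [DecidableEq V] {ι : Type*} [Fintype ι] [DecidableEq ι]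
    (B : V → Matrix ι ι ℂ) (hH : ∀ v, (B v).IsHermitian) (hB : ∀ v, B v * B v = 1)
    (hc : ∀ v w, B v * B w = B w * B v) :
    ∃ P : (V → ℤˣ) → Matrix ι ι ℂ, (∀ a, (P a).PosSemidef) ∧ ∑ a, P a = 1 ∧
      ∀ a v, B v * P a = ((a v : ℤ) : ℂ) • P a := by
  -- The projections are products over `V`, so they are formed in the commutative algebra generated
  -- by the `B v`.
  let S := Algebra.adjoin ℂ (Set.range B)
  have : IsMulCommutative S := Algebra.isMulCommutative_adjoin ℂ (by
    rintro _ ⟨v, rfl⟩ _ ⟨w, rfl⟩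
    exact hc v w)
  let b : V → S := fun v => ⟨B v, Algebra.subset_adjoin ⟨v, rfl⟩⟩
  have hb : ∀ v, b v * b v = 1 := fun v => Subtype.ext (hB v)
  let p : (V → ℤˣ) → S := fun a => ∏ v, (1 / 2 : ℂ) • (1 + ((a v : ℤ) : ℂ) • b v)
  have hp : ∀ a, (p a : Matrix ι ι ℂ).IsHermitian := by
    intro a
    refine Finset.prod_induction _ (fun x : S => (x : Matrix ι ι ℂ).IsHermitian) ?_ ?_ ?_
    · intro x y hx hy
      change ((x : Matrix ι ι ℂ) * (y : Matrix ι ι ℂ))ᴴ = (x : Matrix ι ι ℂ) * (y : Matrix ι ι ℂ)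
      rw [Matrix.conjTranspose_mul, hx.eq, hy.eq]
      exact congrArg Subtype.val (mul_comm y x)
    · exact Matrix.isHermitian_one
    · intro v _
      change ((1 / 2 : ℂ) • (1 + ((a v : ℤ) : ℂ) • B v))ᴴ = _
      simp [Matrix.conjTranspose_smul, (hH v).eq]
      rfl
  refine ⟨fun a => p a, fun a => ?_, ?_, fun a v => ?_⟩
  · have h : (p a : Matrix ι ι ℂ) = (p a : Matrix ι ι ℂ)ᴴ * p a := by
      rw [(hp a).eq]
      exact (congrArg Subtype.val (prod_half_one_add_mul_self b hb a)).symm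
    beta_reduce
    rw [h]
    exact Matrix.posSemidef_conjTranspose_mul_self _
  · have := congrArg Subtype.val (sum_prod_half_one_add b)
    rw [← AddSubmonoidClass.coe_finsetSum]
    exact this
  · exact congrArg Subtype.val (mul_prod_half_one_add b hb a v)

end JointProjections

/-! ### From a state of one family to a parent measurement of another -/

section Dilation

variable {V : Type*} [Fintype V] [DecidableEq V]
variable {ι κ : Type*} [Fintype ι] [DecidableEq ι] [Fintype κ] [DecidableEq κ]

open Kronecker

/-- If `A` and `A'` have the same commutation pattern, then any state in which the expectation
values of `A'` are `± η` yields a parent measurement for the observables `η A`. -/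
theorem exists_povm_of_state (A : V → Matrix ι ι ℂ) (A' : V → Matrix κ κ ℂ)
    (hH : ∀ v, (A v).IsHermitian) (hA : ∀ v, A v * A v = 1)
    (hH' : ∀ v, (A' v).IsHermitian) (hA' : ∀ v, A' v * A' v = 1)
    (hc : ∀ v w, (A v * A w = A w * A v ∧ A' v * A' w = A' w * A' v) ∨
      (A v * A w = -(A w * A v) ∧ A' v * A' w = -(A' w * A' v)))
    (ψ : κ → ℂ) (hψ : star ψ ⬝ᵥ ψ = 1) (c : V → ℤˣ) (η : ℂ)
    (he : ∀ v, star ψ ⬝ᵥ (A' v *ᵥ ψ) = ((c v : ℤ) : ℂ) * η) :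
    ∃ E : (V → ℤˣ) → Matrix ι ι ℂ, ((∀ a, (E a).PosSemidef) ∧ ∑ a, E a = 1) ∧
      ∀ v, ∑ a, ((a v : ℤ) : ℂ) • E a = η • A v := by
  have hcc : ∀ v, ((c v : ℤ) : ℂ) * ((c v : ℤ) : ℂ) = 1 := fun v => by
    rcases Int.units_eq_one_or (c v) with h | h <;> simp [h]
  have hcs : ∀ v, star ((c v : ℤ) : ℂ) = ((c v : ℤ) : ℂ) := fun v => by
    rcases Int.units_eq_one_or (c v) with h | h <;> simp [h]
  obtain ⟨P, hP, hP1, hPB⟩ := exists_joint_projections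
    (fun v => ((c v : ℤ) : ℂ) • (A v ⊗ₖ A' v))
    (fun v => by
      rw [Matrix.IsHermitian, Matrix.conjTranspose_smul, Matrix.conjTranspose_kronecker,
        (hH v).eq, (hH' v).eq, hcs])
    (fun v => by
      rw [smul_mul_smul_comm, hcc, ← Matrix.mul_kronecker_mul, hA, hA', Matrix.one_kronecker_one,
        one_smul])
    (fun v w => by
      rw [smul_mul_smul_comm, smul_mul_smul_comm, ← Matrix.mul_kronecker_mul,
        ← Matrix.mul_kronecker_mul, mul_comm]
      -- If both pairs anti-commute, the two signs cancel in the tensor product.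
      rcases hc v w with h | h
      · rw [h.1, h.2]
      · rw [h.1, h.2]
        congr 1
        ext i j
        simp)
  -- `W` is the isometry `x ↦ x ⊗ ψ`; compressing `X ⊗ Y` by it leaves the expectation of `Y` times
  -- `X`.
  let W : Matrix (ι × κ) ι ℂ := Matrix.of fun p j => (1 : Matrix ι ι ℂ) p.1 j * ψ p.2
  have hWe : ∀ p j, W p j = (1 : Matrix ι ι ℂ) p.1 j * ψ p.2 := fun _ _ => rfl
  have hW : ∀ (X : Matrix ι ι ℂ) (Y : Matrix κ κ ℂ),
      Wᴴ * (X ⊗ₖ Y) * W = (star ψ ⬝ᵥ (Y *ᵥ ψ)) • X := by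
    intro X Y
    have h1 : (X ⊗ₖ Y) * W = Matrix.of fun p j => X p.1 j * (Y *ᵥ ψ) p.2 := by
      ext p j
      simp only [Matrix.mul_apply, hWe, Matrix.kroneckerMap_apply, Fintype.sum_prod_type,
        Matrix.one_apply, Matrix.mulVec, dotProduct, Matrix.of_apply, ite_mul, one_mul, zero_mul, mul_ite, mul_zero]
      rw [Finset.sum_eq_single j (fun b _ hb => by simp [hb]) (by simp), Finset.mul_sum]
      simp [mul_assoc]
    rw [Matrix.mul_assoc, h1]
    ext i j
    simp only [Matrix.mul_apply, Matrix.conjTranspose_apply, hWe, Fintype.sum_prod_type, star_mul',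
      Matrix.one_apply, dotProduct, Matrix.of_apply, Matrix.smul_apply, smul_eq_mul, Pi.star_apply]
    rw [Finset.sum_eq_single i (fun b _ hb => by simp [hb]) (by simp), Finset.sum_mul]
    refine Finset.sum_congr rfl fun k _ => ?_
    simp
    ring
  refine ⟨fun a => Wᴴ * P a * W, ⟨fun a => ?_, ?_⟩, fun v => ?_⟩
  · exact (hP a).conjTranspose_mul_mul_same W
  · rw [← Matrix.sum_mul, ← Matrix.mul_sum, hP1, ← Matrix.one_kronecker_one, hW, Matrix.one_mulVec,
      hψ, one_smul]
  · have : ∑ a, ((a v : ℤ) : ℂ) • P a = ((c v : ℤ) : ℂ) • (A v ⊗ₖ A' v) := by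
      simp only [← hPB]
      rw [← Matrix.mul_sum, hP1, mul_one]
    calc ∑ a, ((a v : ℤ) : ℂ) • (Wᴴ * P a * W)
        = Wᴴ * (∑ a, ((a v : ℤ) : ℂ) • P a) * W := by
          simp only [Matrix.mul_sum, Matrix.sum_mul, Matrix.mul_smul, Matrix.smul_mul]
      _ = η • A v := by
          rw [this, Matrix.mul_smul, Matrix.smul_mul, hW, he, smul_smul, ← mul_assoc, hcc, one_mul]

end Dilation

theorem exists_unit_vector_of_ne_zero {ι : Type*} [Fintype ι] {φ : ι → ℂ} (hφ : φ ≠ 0) :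
    ∃ r : ℂ, star (r • φ) ⬝ᵥ (r • φ) = 1 := by
  have hpos : 0 < star φ ⬝ᵥ φ := by
    rwa [Matrix.dotProduct_star_self_pos_iff]
  obtain ⟨s, hs0, hs⟩ : ∃ s : ℝ, 0 < s ∧ star φ ⬝ᵥ φ = (s : ℂ) :=
    ⟨(star φ ⬝ᵥ φ).re, (Complex.pos_iff.mp hpos).1,
      Complex.ext rfl (by simpa using (Complex.pos_iff.mp hpos).2.symm)⟩
  refine ⟨((√s : ℝ) : ℂ)⁻¹, ?_⟩
  rw [star_smul, smul_dotProduct, dotProduct_smul, hs]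
  simp only [smul_eq_mul, star_inv₀, Complex.star_def, Complex.conj_ofReal]
  have : (√s)⁻¹ * ((√s)⁻¹ * s) = 1 := by
    rw [← mul_assoc, ← mul_inv, Real.mul_self_sqrt hs0.le, inv_mul_cancel₀ hs0.ne']
  exact_mod_cast this

/-! ### Anti-commuting sets: the visibility bound and its equality case -/

section Cliques

variable {ι : Type*} [Fintype ι] [DecidableEq ι]

theorem unit_coe_mul_self (s : ℤˣ) : ((s : ℤ) : ℂ) * ((s : ℤ) : ℂ) = 1 := by
  rcases Int.units_eq_one_or s with h | h <;> simp [h]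

theorem star_unit_coe (s : ℤˣ) : star ((s : ℤ) : ℂ) = ((s : ℤ) : ℂ) := by
  rcases Int.units_eq_one_or s with h | h <;> simp [h]

-- Factor `R = Yᴴ Y`; the hypothesis becomes `(Y X)ᴴ (Y X) = 0`, so `Y X = 0`.
open scoped MatrixOrder Matrix.Norms.L2Operator in
theorem Matrix.PosSemidef.mul_eq_zero_of_conj_eq_zero {κ : Type*} [Fintype κ]
    {R : Matrix ι ι ℂ} {X : Matrix ι κ ℂ} (hR : R.PosSemidef)
    (h : Xᴴ * R * X = 0) : R * X = 0 := by
  obtain ⟨Y, rfl⟩ := CStarAlgebra.nonneg_iff_eq_star_mul_self.mp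
    (Matrix.nonneg_iff_posSemidef.mpr hR)
  rw [Matrix.star_eq_conjTranspose] at h ⊢
  have : (Y * X)ᴴ * (Y * X) = 0 := by
    rw [Matrix.conjTranspose_mul, ← h]
    simp only [Matrix.mul_assoc]
  rw [Matrix.conjTranspose_mul_self_eq_zero] at this
  rw [Matrix.mul_assoc, this, Matrix.mul_zero]

/-- `X = l - H` satisfies `X² = 2 l X`, that is, it is a multiple of a projection when `l ≠ 0`. This
turns `tr (R X)` into the trace of a congruence of `R`, whose sign and vanishing are controlled by
positivity. -/
theorem two_mul_trace_mul_sub {R H : Matrix ι ι ℂ} {l : ℝ} (hH : H.IsHermitian)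
    (hsq : H * H = ((l : ℂ) * l) • 1) :
    2 * (l : ℂ) * (R * ((l : ℂ) • 1 - H)).trace =
      (((l : ℂ) • 1 - H)ᴴ * R * ((l : ℂ) • 1 - H)).trace := by
  have hX : ((l : ℂ) • 1 - H)ᴴ = (l : ℂ) • 1 - H := by
    simp [Matrix.conjTranspose_smul, hH.eq]
  have hXX : ((l : ℂ) • 1 - H) * ((l : ℂ) • 1 - H) = (2 * (l : ℂ)) • ((l : ℂ) • 1 - H) := by
    simp only [sub_mul, mul_sub, smul_mul_assoc, mul_smul_comm, one_mul, mul_one, hsq]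
    module
  rw [hX, Matrix.mul_assoc, Matrix.trace_mul_comm _ (R * _), Matrix.mul_assoc, hXX, Matrix.mul_smul,
    Matrix.trace_smul, smul_eq_mul]

theorem trace_mul_sub_nonneg {R H : Matrix ι ι ℂ} {l : ℝ} (hl : 0 < l) (hR : R.PosSemidef)
    (hH : H.IsHermitian) (hsq : H * H = ((l : ℂ) * l) • 1) :
    0 ≤ (R * ((l : ℂ) • 1 - H)).trace := by
  have h := (hR.conjTranspose_mul_mul_same ((l : ℂ) • 1 - H)).trace_nonneg
  rw [← two_mul_trace_mul_sub hH hsq] at h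
  have h2 : (0 : ℂ) < 2 * (l : ℂ) := by exact_mod_cast (by positivity : (0 : ℝ) < 2 * l)
  have h3 := mul_nonneg (inv_nonneg.mpr h2.le) h
  rwa [inv_mul_cancel_left₀ h2.ne'] at h3

theorem mul_eq_smul_of_trace_eq_zero {R H : Matrix ι ι ℂ} {l : ℝ} (hR : R.PosSemidef)
    (hH : H.IsHermitian) (hsq : H * H = ((l : ℂ) * l) • 1)
    (h0 : (R * ((l : ℂ) • 1 - H)).trace = 0) : R * H = (l : ℂ) • R ∧ H * R = (l : ℂ) • R := by
  have h := two_mul_trace_mul_sub (R := R) hH hsq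
  rw [h0, mul_zero, eq_comm,
    (hR.conjTranspose_mul_mul_same ((l : ℂ) • 1 - H)).trace_eq_zero_iff] at h
  have h1 := hR.mul_eq_zero_of_conj_eq_zero h
  rw [Matrix.mul_sub, sub_eq_zero, Matrix.mul_smul, Matrix.mul_one] at h1
  refine ⟨h1.symm, ?_⟩
  have h2 := congrArg Matrix.conjTranspose h1
  rw [Matrix.conjTranspose_mul, Matrix.conjTranspose_smul, hR.1.eq, hH.eq] at h2
  simpa using h2.symm

variable {V : Type*} {A : V → Matrix ι ι ℂ}

/-- The signed sum of observables over a set of vertices. -/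
def signedSum (A : V → Matrix ι ι ℂ) (K : Finset V) (a : V → ℤˣ) : Matrix ι ι ℂ :=
  ∑ v ∈ K, ((a v : ℤ) : ℂ) • A v

omit [Fintype ι] [DecidableEq ι] in
theorem signedSum_isHermitian (hH : ∀ v, (A v).IsHermitian) (K : Finset V) (a : V → ℤˣ) :
    (signedSum A K a).IsHermitian := by
  rw [Matrix.IsHermitian, signedSum, Matrix.conjTranspose_sum]
  refine Finset.sum_congr rfl fun v _ => ?_
  rw [Matrix.conjTranspose_smul, (hH v).eq, star_unit_coe]

theorem anticommutator_signedSum [DecidableEq V] (hA : ∀ v, A v * A v = 1) {K : Finset V}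
    (hK : ∀ v ∈ K, ∀ w ∈ K, v ≠ w → A v * A w = -(A w * A v)) (a : V → ℤˣ) {v : V} (hv : v ∈ K) :
    A v * signedSum A K a + signedSum A K a * A v = (2 * ((a v : ℤ) : ℂ)) • 1 := by
  rw [signedSum, Finset.mul_sum, Finset.sum_mul, ← Finset.sum_add_distrib,
    Finset.sum_eq_single_of_mem v hv]
  · rw [mul_smul_comm, smul_mul_assoc, hA, ← add_smul, two_mul]
  · intro w hw hwv
    rw [mul_smul_comm, smul_mul_assoc, hK v hv w hw hwv.symm, ← smul_add, neg_add_cancel,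
      smul_zero]

/-- Twice the square is the signed sum of the anti-commutators of the `A v` with the sum, each equal
to `2 * a v`. -/
theorem signedSum_mul_self [DecidableEq V] (hA : ∀ v, A v * A v = 1) {K : Finset V}
    (hK : ∀ v ∈ K, ∀ w ∈ K, v ≠ w → A v * A w = -(A w * A v)) (a : V → ℤˣ) :
    signedSum A K a * signedSum A K a = (K.card : ℂ) • 1 := by
  have h : (2 : ℂ) • (signedSum A K a * signedSum A K a) =
      ∑ v ∈ K, ((a v : ℤ) : ℂ) • (A v * signedSum A K a + signedSum A K a * A v) := by
    rw [two_smul]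
    nth_rewrite 1 [signedSum]
    nth_rewrite 3 [signedSum]
    simp only [Finset.sum_mul, Finset.mul_sum, ← Finset.sum_add_distrib, smul_add, smul_mul_assoc,
      mul_smul_comm]
  rw [Finset.sum_congr rfl fun v hv => by rw [anticommutator_signedSum hA hK a hv]] at h
  simp only [smul_smul] at h
  rw [Finset.sum_congr rfl fun v _ => by
    rw [mul_left_comm, unit_coe_mul_self, mul_one], Finset.sum_const, ← Nat.cast_smul_eq_nsmul ℂ,
    smul_smul, mul_comm, ← smul_smul] at h
  exact smul_right_injective _ (two_ne_zero' ℂ) h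

variable [Fintype V] [DecidableEq V] {E : (V → ℤˣ) → Matrix ι ι ℂ} {η : ℝ}

/-- Exchanging the sums, the marginal condition turns `∑ a, E a * signedSum A K a` into `η ∑ v ∈ K,
(A v)² = η * K.card`. -/
theorem sum_trace_mul_sub_signedSum (hA : ∀ v, A v * A v = 1) (hE : ∑ a, E a = 1)
    (hm : ∀ v, ∑ a, ((a v : ℤ) : ℂ) • E a = (η : ℂ) • A v) (K : Finset V) (l : ℝ) :
    ∑ a, (E a * ((l : ℂ) • 1 - signedSum A K a)).trace =
      (((l - η * K.card) * Fintype.card ι : ℝ) : ℂ) := by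
  have h : ∑ a, E a * signedSum A K a = (η * (K.card : ℂ)) • 1 := by
    simp only [signedSum, Finset.mul_sum, mul_smul_comm]
    rw [Finset.sum_comm]
    have : ∀ v ∈ K, ∑ a, ((a v : ℤ) : ℂ) • (E a * A v) = (η : ℂ) • 1 := fun v _ => by
      simp only [← smul_mul_assoc]
      rw [← Finset.sum_mul, hm, smul_mul_assoc, hA]
    rw [Finset.sum_congr rfl this, Finset.sum_const, ← Nat.cast_smul_eq_nsmul ℂ, smul_smul,
      mul_comm]
  rw [← Matrix.trace_sum]
  simp only [mul_sub, mul_smul_comm, mul_one]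
  rw [Finset.sum_sub_distrib, ← Finset.smul_sum, hE, h, ← sub_smul, Matrix.trace_smul,
    Matrix.trace_one]
  push_cast
  rfl

omit [Fintype V] [DecidableEq V] in
theorem sqrt_card_mul_self (K : Finset V) :
    ((√(K.card : ℝ) : ℝ) : ℂ) * ((√(K.card : ℝ) : ℝ) : ℂ) = (K.card : ℂ) := by
  rw [← Complex.ofReal_mul, Real.mul_self_sqrt (Nat.cast_nonneg _), Complex.ofReal_natCast]

/-- A jointly measurable family of noisy observables has visibility at most `1 / √k` if it
contains `k` pairwise anti-commuting observables. -/
theorem le_one_div_sqrt_card_of_clique [Nonempty ι] (hH : ∀ v, (A v).IsHermitian)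
    (hA : ∀ v, A v * A v = 1) (hP : ∀ a, (E a).PosSemidef) (hE : ∑ a, E a = 1)
    (hm : ∀ v, ∑ a, ((a v : ℤ) : ℂ) • E a = (η : ℂ) • A v) {K : Finset V} (hK0 : K.Nonempty)
    (hK : ∀ v ∈ K, ∀ w ∈ K, v ≠ w → A v * A w = -(A w * A v)) :
    η ≤ 1 / √(K.card : ℝ) := by
  have hk : (0 : ℝ) < K.card := Nat.cast_pos.mpr hK0.card_pos
  have hl := Real.sqrt_pos.mpr hk
  have h := Finset.sum_nonneg fun a (_ : a ∈ Finset.univ) =>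
    trace_mul_sub_nonneg hl (hP a) (signedSum_isHermitian hH K a)
      (by rw [signedSum_mul_self hA hK, sqrt_card_mul_self])
  rw [sum_trace_mul_sub_signedSum hA hE hm] at h
  have h' : 0 ≤ (√(K.card : ℝ) - η * K.card) * Fintype.card ι := by exact_mod_cast h
  have hd : (0 : ℝ) < Fintype.card ι := Nat.cast_pos.mpr Fintype.card_pos
  have h'' := nonneg_of_mul_nonneg_left h' hd
  rw [le_div_iff₀ hl]
  have hs : √(K.card : ℝ) * √(K.card : ℝ) = K.card := Real.mul_self_sqrt hk.le
  nlinarith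

/-- At `η = 1 / √k` nonnegative traces add up to zero, so each vanishes. -/
theorem signedSum_mul_eq_of_tight (hH : ∀ v, (A v).IsHermitian)
    (hA : ∀ v, A v * A v = 1) (hP : ∀ a, (E a).PosSemidef) (hE : ∑ a, E a = 1)
    {K : Finset V} (hK0 : K.Nonempty)
    (hm : ∀ v, ∑ a, ((a v : ℤ) : ℂ) • E a = ((1 / √(K.card : ℝ) : ℝ) : ℂ) • A v)
    (hK : ∀ v ∈ K, ∀ w ∈ K, v ≠ w → A v * A w = -(A w * A v)) (a : V → ℤˣ) :
    E a * signedSum A K a = ((√(K.card : ℝ) : ℝ) : ℂ) • E a ∧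
      signedSum A K a * E a = ((√(K.card : ℝ) : ℝ) : ℂ) • E a := by
  have hk : (0 : ℝ) < K.card := Nat.cast_pos.mpr hK0.card_pos
  have hl := Real.sqrt_pos.mpr hk
  have hsq : ∀ a, signedSum A K a * signedSum A K a =
      (((√(K.card : ℝ) : ℝ) : ℂ) * ((√(K.card : ℝ) : ℝ) : ℂ)) • 1 := fun a => by
    rw [signedSum_mul_self hA hK, sqrt_card_mul_self]
  have h := sum_trace_mul_sub_signedSum hA hE hm K (√(K.card : ℝ))
  rw [one_div, ← Real.sqrt_div_self, div_mul_cancel₀ _ hk.ne', sub_self, zero_mul,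
    Complex.ofReal_zero, Finset.sum_eq_zero_iff_of_nonneg fun a _ =>
    trace_mul_sub_nonneg hl (hP a) (signedSum_isHermitian hH K a) (hsq a)] at h
  exact mul_eq_smul_of_trace_eq_zero (hP a) (signedSum_isHermitian hH K a) (hsq a)
    (h a (Finset.mem_univ a))

/-- If every observable lies in a set of `k` pairwise anti-commuting ones, a parent measurement at
visibility `1 / √k` yields a state in which all expectation values are `± 1 / √k`. -/
theorem exists_state_of_tight [Nonempty ι] (hH : ∀ v, (A v).IsHermitian)
    (hA : ∀ v, A v * A v = 1) (hP : ∀ a, (E a).PosSemidef) (hE : ∑ a, E a = 1) {k : ℕ}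
    (hm : ∀ v, ∑ a, ((a v : ℤ) : ℂ) • E a = ((1 / √(k : ℝ) : ℝ) : ℂ) • A v)
    (hK : ∀ v, ∃ K : Finset V, v ∈ K ∧ K.card = k ∧
      ∀ v ∈ K, ∀ w ∈ K, v ≠ w → A v * A w = -(A w * A v)) :
    ∃ (ψ : ι → ℂ) (a : V → ℤˣ), star ψ ⬝ᵥ ψ = 1 ∧
      ∀ v, star ψ ⬝ᵥ (A v *ᵥ ψ) = ((a v : ℤ) : ℂ) * ((1 / √(k : ℝ) : ℝ) : ℂ) := by
  obtain ⟨a, ha⟩ : ∃ a, E a ≠ 0 := by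
    by_contra! h
    simp [h] at hE
  obtain ⟨j, hj⟩ : ∃ j, (E a)ᵀ j ≠ 0 := by
    by_contra! h
    exact ha (Matrix.transpose_injective (Matrix.ext fun i j => congrFun (h i) j))
  set φ : ι → ℂ := (E a)ᵀ j with hφ
  -- Since `E a` is Hermitian, expectations in its column `φ` are diagonal entries of `E a * X * E
  -- a`.
  have hφφ : ∀ X : Matrix ι ι ℂ, star φ ⬝ᵥ (X *ᵥ φ) = (E a * X * E a) j j := by
    intro X
    have h1 : star φ = (E a) j := by
      ext i
      rw [Pi.star_apply, hφ, Matrix.transpose_apply, (hP a).1.apply]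
    rw [h1, Matrix.mul_assoc]
    rfl
  have hexp : ∀ v, star φ ⬝ᵥ (A v *ᵥ φ) =
      ((a v : ℤ) : ℂ) * ((1 / √(k : ℝ) : ℝ) : ℂ) * (star φ ⬝ᵥ φ) := by
    intro v
    obtain ⟨K, hvK, rfl, hKK⟩ := hK v
    have hk : (0 : ℝ) < K.card := Nat.cast_pos.mpr (Finset.card_pos.mpr ⟨v, hvK⟩)
    have hl := Real.sqrt_pos.mpr hk
    obtain ⟨h1, h2⟩ := signedSum_mul_eq_of_tight hH hA hP hE ⟨v, hvK⟩ hm hKK a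
    -- Sandwich the anti-commutator between two copies of `E a`: both signed sums become `√k`,
    -- leaving `2 √k E A E = 2 (a v) E E`.
    have h3 := congrArg (fun X => E a * X * E a) (anticommutator_signedSum hA hKK a hvK)
    simp only [mul_add, add_mul] at h3
    rw [Matrix.mul_assoc (E a) (A v * _), Matrix.mul_assoc (A v), h2, ← Matrix.mul_assoc (E a) _ (A v),
      h1] at h3
    have h4 := hφφ (A v)
    have h5 := hφφ 1
    rw [Matrix.one_mulVec] at h5
    rw [h4, h5]
    have h6 := congrFun (congrFun h3 j) j
    simp only [Matrix.mul_smul, Matrix.smul_mul, Matrix.add_apply, Matrix.smul_apply, smul_eq_mul,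
      Matrix.mul_assoc] at h6 ⊢
    have hl' : ((√(K.card : ℝ) : ℝ) : ℂ) ≠ 0 := by exact_mod_cast hl.ne'
    push_cast
    field_simp
    linear_combination (1 / 2 : ℂ) * h6
  obtain ⟨r, hr⟩ := exists_unit_vector_of_ne_zero hj
  refine ⟨r • φ, a, hr, fun v => ?_⟩
  rw [← mul_one (_ * _), ← hr, Matrix.mulVec_smul, star_smul, smul_dotProduct, dotProduct_smul,
    smul_dotProduct, dotProduct_smul, hexp]
  simp only [smul_eq_mul]
  ring

end Cliques

/-! ### Compactness of the set of admissible noise parameters -/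

section Compactness

variable {V : Type*} [Fintype V] [DecidableEq V] {d : ℕ}

-- Each effect lies between `0` and `1`, so it has operator norm at most `1`; the defining
-- conditions are closed.
open scoped MatrixOrder Matrix.Norms.L2Operator in
theorem isCompact_setOf_isPOVM {Ω : Type*} [Fintype Ω] :
    IsCompact {E : Ω → Matrix (Fin d) (Fin d) ℂ | IsPOVM E} := by
  have hcl : IsClosed {E : Ω → Matrix (Fin d) (Fin d) ℂ | IsPOVM E} := by
    have : {E : Ω → Matrix (Fin d) (Fin d) ℂ | IsPOVM E} =
        (⋂ a, (fun E : Ω → Matrix (Fin d) (Fin d) ℂ => E a) ⁻¹' Set.Ici 0) ∩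
          {E | ∑ a, E a = 1} := by
      ext E
      simp [IsPOVM, Matrix.nonneg_iff_posSemidef]
    rw [this]
    exact (isClosed_iInter fun a => isClosed_Ici.preimage (continuous_apply a)).inter
      (isClosed_eq (by fun_prop) continuous_const)
  refine (isCompact_univ_pi fun _ : Ω =>
    isCompact_closedBall (0 : Matrix (Fin d) (Fin d) ℂ) 1).of_isClosed_subset hcl ?_
  intro E hE a _
  rw [mem_closedBall_zero_iff]
  have h0 : ∀ b, 0 ≤ E b := fun b => Matrix.nonneg_iff_posSemidef.mpr (hE.1 b)
  rw [CStarAlgebra.norm_le_one_iff_of_nonneg _ (h0 a), ← hE.2]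
  exact Finset.single_le_sum (fun b _ => h0 b) (Finset.mem_univ a)

theorem isCompact_jointMeasurabilitySet (A : V → Matrix (Fin d) (Fin d) ℂ) :
    IsCompact (jointMeasurabilitySet A) := by
  have h : jointMeasurabilitySet A = Prod.fst ''
      ((Set.Icc (0 : ℝ) 1 ×ˢ {E : (V → ℤˣ) → Matrix (Fin d) (Fin d) ℂ | IsPOVM E}) ∩
        ⋂ v, {x | ∑ a, ((a v : ℤ) : ℂ) • x.2 a = noisyObservable x.1 (A v)}) := by
    ext η
    simp only [jointMeasurabilitySet, Set.mem_ofPred_eq, jointlyMeasurable_binaryEffect_iff,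
      Set.mem_image, Set.mem_inter_iff, Set.mem_prod, Set.mem_iInter, Prod.exists,
      exists_and_right, exists_eq_right]
    exact ⟨fun ⟨h1, E, h2, h3⟩ => ⟨E, ⟨h1, h2⟩, h3⟩, fun ⟨E, ⟨h1, h2⟩, h3⟩ => ⟨h1, E, h2, h3⟩⟩
  rw [h]
  refine ((isCompact_Icc.prod isCompact_setOf_isPOVM).inter_right
    (isClosed_iInter fun v => isClosed_eq ?_ ?_)).image continuous_fst
  · fun_prop
  · unfold noisyObservable
    fun_prop

theorem noisyObservable_of_trace_eq_zero {A : Matrix (Fin d) (Fin d) ℂ} (h : A.trace = 0) (η : ℝ) :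
    noisyObservable η A = (η : ℂ) • A := by
  simp [noisyObservable, h]

theorem noisyObservable_one (A : Matrix (Fin d) (Fin d) ℂ) : noisyObservable 1 A = A := by
  simp [noisyObservable]

theorem trace_eq_zero_of_anticommute {ι : Type*} [Fintype ι] [DecidableEq ι] {A B : Matrix ι ι ℂ}
    (hB : B * B = 1) (h : A * B = -(B * A)) : A.trace = 0 := by
  have h1 : A.trace = -A.trace := by
    calc A.trace = (A * B * B).trace := by rw [Matrix.mul_assoc, hB, Matrix.mul_one]
      _ = -(B * A * B).trace := by rw [h, Matrix.neg_mul, Matrix.trace_neg]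
      _ = -(B * B * A).trace := by rw [Matrix.mul_assoc, Matrix.trace_mul_comm B, Matrix.mul_assoc,
          Matrix.trace_mul_comm A]
      _ = -A.trace := by rw [hB, Matrix.one_mul]
  exact self_eq_neg.mp h1

/-- For traceless observables the noise at `η = 0` is unbiased, so uniformly random signs serve as a
parent. -/
theorem zero_mem_jointMeasurabilitySet {A : V → Matrix (Fin d) (Fin d) ℂ}
    (hA : ∀ v, (A v).trace = 0) : (0 : ℝ) ∈ jointMeasurabilitySet A := by
  refine ⟨by simp, (jointlyMeasurable_binaryEffect_iff _).mpr
    ⟨fun _ => (Fintype.card (V → ℤˣ) : ℂ)⁻¹ • 1, ⟨fun a => ?_, ?_⟩, fun v => ?_⟩⟩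
  · exact Matrix.PosSemidef.one.smul (by positivity)
  · rw [Finset.sum_const, Finset.card_univ, ← Nat.cast_smul_eq_nsmul ℂ, smul_smul,
      mul_inv_cancel₀ (Nat.cast_ne_zero.mpr Fintype.card_ne_zero), one_smul]
  · have h : ∑ a : V → ℤˣ, ((a v : ℤ) : ℂ) = 0 := by
      have := Equiv.sum_comp (Equiv.neg (V → ℤˣ)) fun a : V → ℤˣ => ((a v : ℤ) : ℂ)
      simp only [Equiv.neg_apply, Pi.neg_apply, Units.val_neg, Int.cast_neg,
        Finset.sum_neg_distrib] at this
      exact neg_eq_self.mp this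
    rw [← Finset.sum_smul, h, noisyObservable_of_trace_eq_zero (hA v)]
    simp

end Compactness

/-! ### Pairs of points and star cliques in `J(n, 2)` -/

section JohnsonGraph

variable {n : ℕ}

theorem exists_lt_eq_pair (e : {s : Finset (Fin n) // s.card = 2}) :
    ∃ u v, u < v ∧ e.1 = {u, v} := by
  obtain ⟨u, v, huv, he⟩ := Finset.card_eq_two.mp e.2
  rcases lt_or_gt_of_ne huv with h | h
  · exact ⟨u, v, h, he⟩
  · exact ⟨v, u, h, by rw [he, Finset.pair_comm]⟩

theorem exists_pairs_of_johnsonGraph_adj {e f : {s : Finset (Fin n) // s.card = 2}}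
    (h : (johnsonGraph n 2).Adj e f) :
    ∃ u v w, u ≠ v ∧ u ≠ w ∧ v ≠ w ∧ e.1 = {u, v} ∧ f.1 = {u, w} := by
  have h1 : (e.1 ∩ f.1).card = 1 := Nat.succ.inj h
  obtain ⟨u, hu⟩ := Finset.card_eq_one.mp h1
  have hm : ∀ x, x ∈ e.1 ∧ x ∈ f.1 ↔ x = u := fun x => by
    rw [← Finset.mem_inter, hu, Finset.mem_singleton]
  have key : ∀ g : {s : Finset (Fin n) // s.card = 2}, u ∈ g.1 → ∃ v, u ≠ v ∧ g.1 = {u, v} := by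
    intro g hg
    obtain ⟨v, hv⟩ := Finset.card_eq_one.mp
      (by rw [Finset.card_erase_of_mem hg, g.2] : (g.1.erase u).card = 1)
    have hvm : v ∈ g.1.erase u := by simp [hv]
    exact ⟨v, (Finset.ne_of_mem_erase hvm).symm, by rw [← hv, Finset.insert_erase hg]⟩
  obtain ⟨v, huv, he⟩ := key e ((hm u).mpr rfl).1
  obtain ⟨w, huw, hf⟩ := key f ((hm u).mpr rfl).2
  refine ⟨u, v, w, huv, huw, ?_, he, hf⟩
  rintro rfl
  exact huv ((hm v).mp ⟨by simp [he], by simp [hf]⟩).symm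

theorem eq_or_disjoint_of_not_johnsonGraph_adj {e f : {s : Finset (Fin n) // s.card = 2}}
    (h : ¬ (johnsonGraph n 2).Adj e f) : e = f ∨ Disjoint e.1 f.1 := by
  have h1 : (e.1 ∩ f.1).card ≠ 1 := fun h' => h (by change _ + 1 = 2; omega)
  have h2 : (e.1 ∩ f.1).card ≤ 2 :=
    (Finset.card_le_card Finset.inter_subset_left).trans_eq e.2
  rcases Nat.lt_or_ge (e.1 ∩ f.1).card 2 with h3 | h3
  · right
    rw [Finset.disjoint_iff_inter_eq_empty, ← Finset.card_eq_zero]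
    omega
  · left
    have h4 := Finset.eq_of_subset_of_card_le (Finset.inter_subset_left (s₁ := e.1) (s₂ := f.1))
      (by rw [e.2]; exact h3)
    have h5 := Finset.eq_of_subset_of_card_le (Finset.inter_subset_right (s₁ := e.1) (s₂ := f.1))
      (by rw [f.2]; exact h3)
    exact Subtype.ext (h4.symm.trans h5)

theorem johnsonGraph_adj_of_mem {e f : {s : Finset (Fin n) // s.card = 2}} {u : Fin n}
    (he : u ∈ e.1) (hf : u ∈ f.1) (hef : e ≠ f) : (johnsonGraph n 2).Adj e f := by
  by_contra h
  rcases eq_or_disjoint_of_not_johnsonGraph_adj h with h' | h'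
  · exact hef h'
  · exact Finset.disjoint_left.mp h' he hf

/-- The edge joining two distinct points. -/
def pairEdge (u v : Fin n) (h : u ≠ v) : {s : Finset (Fin n) // s.card = 2} :=
  ⟨{u, v}, Finset.card_pair h⟩

theorem card_filter_mem_edges (u : Fin n) :
    (Finset.univ.filter fun e : {s : Finset (Fin n) // s.card = 2} => u ∈ e.1).card = n - 1 := by
  have h : (Finset.univ.erase u : Finset (Fin n)).card = n - 1 := by
    rw [Finset.card_erase_of_mem (Finset.mem_univ u), Finset.card_univ, Fintype.card_fin]
  rw [← h]
  symm
  refine Finset.card_bij (fun v hv => pairEdge u v (Finset.ne_of_mem_erase hv).symm) ?_ ?_ ?_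
  · intro v _
    simp [pairEdge]
  · intro v hv w hw hvw
    have h1 : v ∈ ({u, w} : Finset (Fin n)) := by
      have h2 : ({u, v} : Finset (Fin n)) = {u, w} := congrArg Subtype.val hvw
      rw [← h2]
      simp
    simpa [Finset.ne_of_mem_erase hv] using h1
  · intro e he
    have hu : u ∈ e.1 := (Finset.mem_filter.mp he).2
    obtain ⟨v, hv⟩ := Finset.card_eq_one.mp
      (by rw [Finset.card_erase_of_mem hu, e.2] : (e.1.erase u).card = 1)
    have hvm : v ∈ e.1.erase u := by simp [hv]
    refine ⟨v, Finset.mem_erase.mpr ⟨Finset.ne_of_mem_erase hvm, Finset.mem_univ v⟩,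
      Subtype.ext ?_⟩
    change {u, v} = e.1
    rw [← hv, Finset.insert_erase hu]

theorem exists_star_clique {ι : Type*} [Fintype ι]
    {A : {s : Finset (Fin n) // s.card = 2} → Matrix ι ι ℂ}
    (hA : ∀ e f, (johnsonGraph n 2).Adj e f → A e * A f = -(A f * A e))
    (e : {s : Finset (Fin n) // s.card = 2}) :
    ∃ K : Finset {s : Finset (Fin n) // s.card = 2}, e ∈ K ∧ K.card = n - 1 ∧
      ∀ e ∈ K, ∀ f ∈ K, e ≠ f → A e * A f = -(A f * A e) := by
  obtain ⟨u, hu⟩ := nonempty_of_card_two e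
  refine ⟨Finset.univ.filter fun e => u ∈ e.1, by simpa using hu, card_filter_mem_edges u, ?_⟩
  intro e he f hf hef
  exact hA e f (johnsonGraph_adj_of_mem (Finset.mem_filter.mp he).2 (Finset.mem_filter.mp hf).2 hef)

end JohnsonGraph

/-! ### Majorana operators and their quadratic observables -/

section Majorana

theorem commute_mul_of_anticommute {R : Type*} [Ring R] {a b x : R} (ha : a * x = -(x * a))
    (hb : b * x = -(x * b)) : Commute (a * b) x := by
  change a * b * x = x * (a * b)
  rw [mul_assoc, hb, mul_neg, ← mul_assoc, ha, neg_mul, neg_neg, mul_assoc]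

variable {n d : ℕ} {Γ : Fin n → Matrix (Fin d) (Fin d) ℂ}

theorem IsMajoranaFamily.anticommute (hΓ : IsMajoranaFamily Γ) {u v : Fin n} (h : u ≠ v) :
    Γ u * Γ v = -(Γ v * Γ u) := eq_neg_of_add_eq_zero_left (hΓ.2.2 u v h)

theorem quadraticMajorana_eq {e : {s : Finset (Fin n) // s.card = 2}} {u v : Fin n} (h : u < v)
    (he : e.1 = {u, v}) : quadraticMajorana Γ e = Complex.I • (Γ u * Γ v) := by
  obtain ⟨e, he'⟩ := e
  change e = {u, v} at he
  subst he
  have h1 : ({u, v} : Finset (Fin n)).min' (nonempty_of_card_two ⟨_, he'⟩) = u := by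
    rw [Finset.min'_eq_iff]
    simp [h.le]
  have h2 : ({u, v} : Finset (Fin n)).max' (nonempty_of_card_two ⟨_, he'⟩) = v := by
    rw [Finset.max'_eq_iff]
    simp [h.le]
  rw [quadraticMajorana]
  simp only [h1, h2]

/-- Scalars do not affect (anti-)commutation, so the order of the two points can be forgotten. -/
theorem IsMajoranaFamily.exists_quadraticMajorana_eq (hΓ : IsMajoranaFamily Γ)
    {e : {s : Finset (Fin n) // s.card = 2}} {u v : Fin n} (h : u ≠ v) (he : e.1 = {u, v}) :
    ∃ c : ℂ, quadraticMajorana Γ e = c • (Γ u * Γ v) := by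
  rcases lt_or_gt_of_ne h with h' | h'
  · exact ⟨_, quadraticMajorana_eq h' he⟩
  · exact ⟨-Complex.I, by
      rw [quadraticMajorana_eq h' (by rw [he, Finset.pair_comm]), hΓ.anticommute h]
      simp⟩

theorem IsMajoranaFamily.quadraticMajorana_anticommute (hΓ : IsMajoranaFamily Γ)
    {e f : {s : Finset (Fin n) // s.card = 2}} (h : (johnsonGraph n 2).Adj e f) :
    quadraticMajorana Γ e * quadraticMajorana Γ f =
      -(quadraticMajorana Γ f * quadraticMajorana Γ e) := by
  obtain ⟨u, v, w, huv, huw, hvw, he, hf⟩ := exists_pairs_of_johnsonGraph_adj h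
  obtain ⟨c, hc⟩ := hΓ.exists_quadraticMajorana_eq huv he
  obtain ⟨c', hc'⟩ := hΓ.exists_quadraticMajorana_eq huw hf
  have h1 : Γ u * Γ v * Γ u = -(Γ u * (Γ u * Γ v)) := by
    rw [Matrix.mul_assoc, hΓ.anticommute huv.symm, mul_neg]
  have h2 : Γ u * Γ v * Γ w = Γ w * (Γ u * Γ v) :=
    commute_mul_of_anticommute (hΓ.anticommute huw) (hΓ.anticommute hvw)
  have h3 : Γ u * Γ v * (Γ u * Γ w) = -(Γ u * Γ w * (Γ u * Γ v)) := by
    rw [← Matrix.mul_assoc, h1, Matrix.neg_mul, Matrix.mul_assoc, h2, ← Matrix.mul_assoc]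
  rw [hc, hc', smul_mul_smul_comm, smul_mul_smul_comm, h3, mul_comm c, smul_neg]

theorem IsMajoranaFamily.quadraticMajorana_commute (hΓ : IsMajoranaFamily Γ)
    {e f : {s : Finset (Fin n) // s.card = 2}} (h : ¬ (johnsonGraph n 2).Adj e f) :
    quadraticMajorana Γ e * quadraticMajorana Γ f =
      quadraticMajorana Γ f * quadraticMajorana Γ e := by
  rcases eq_or_disjoint_of_not_johnsonGraph_adj h with rfl | hd
  · rfl
  obtain ⟨u, v, huv, he⟩ := exists_lt_eq_pair e
  obtain ⟨w, x, hwx, hf⟩ := exists_lt_eq_pair f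
  rw [he, hf] at hd
  simp only [Finset.disjoint_insert_right, Finset.disjoint_singleton_right, Finset.mem_insert,
    Finset.mem_singleton, not_or] at hd
  obtain ⟨⟨h1, h2⟩, h3, h4⟩ := hd
  rw [quadraticMajorana_eq huv he, quadraticMajorana_eq hwx hf, smul_mul_smul_comm,
    smul_mul_smul_comm]
  congr 1
  exact (commute_mul_of_anticommute (hΓ.anticommute (Ne.symm h1))
    (hΓ.anticommute (Ne.symm h2))).mul_right (commute_mul_of_anticommute (hΓ.anticommute (Ne.symm h3)) (hΓ.anticommute (Ne.symm h4)))

theorem isHermitian_I_smul_mul {ι : Type*} [Fintype ι] {X Y : Matrix ι ι ℂ} (hX : X.IsHermitian)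
    (hY : Y.IsHermitian) (h : X * Y = -(Y * X)) : (Complex.I • (X * Y)).IsHermitian := by
  rw [Matrix.IsHermitian, Matrix.conjTranspose_smul, Matrix.conjTranspose_mul, hX.eq, hY.eq, h]
  simp

theorem I_smul_mul_mul_self {ι : Type*} [Fintype ι] [DecidableEq ι] {X Y : Matrix ι ι ℂ}
    (hX : X * X = 1) (hY : Y * Y = 1) (h : X * Y = -(Y * X)) :
    (Complex.I • (X * Y)) * (Complex.I • (X * Y)) = 1 := by
  rw [smul_mul_smul_comm, Complex.I_mul_I]
  nth_rewrite 2 [h]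
  rw [mul_neg, Matrix.mul_assoc, ← Matrix.mul_assoc Y, hY, Matrix.one_mul, hX]
  simp

theorem IsMajoranaFamily.isBinaryObservableFamily (hΓ : IsMajoranaFamily Γ) :
    IsBinaryObservableFamily (quadraticMajorana Γ) := by
  intro e
  obtain ⟨u, v, huv, he⟩ := exists_lt_eq_pair e
  rw [quadraticMajorana_eq huv he]
  have h := hΓ.anticommute huv.ne
  exact ⟨isHermitian_I_smul_mul (hΓ.1 u) (hΓ.1 v) h, I_smul_mul_mul_self (hΓ.2.1 u) (hΓ.2.1 v) h⟩

theorem IsMajoranaFamily.isAnticommutativityGraph (hd : 0 < d) (hΓ : IsMajoranaFamily Γ) :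
    IsAnticommutativityGraph (johnsonGraph n 2) (quadraticMajorana Γ) := by
  refine ⟨fun e f => ⟨hΓ.quadraticMajorana_anticommute, fun h => ?_⟩,
    fun e f => hΓ.quadraticMajorana_commute⟩
  by_contra hadj
  have h1 := hΓ.quadraticMajorana_commute hadj
  rw [h1, ← sub_eq_zero, sub_neg_eq_add, ← two_smul ℂ, smul_eq_zero_iff_right two_ne_zero] at h
  have he := (hΓ.isBinaryObservableFamily e).2
  have hf := (hΓ.isBinaryObservableFamily f).2
  -- Observables that both commute and anti-commute have product zero, impossible for involutions in
  -- positive dimension.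
  have : Nonempty (Fin d) := ⟨⟨0, hd⟩⟩
  apply one_ne_zero (α := Matrix (Fin d) (Fin d) ℂ)
  calc (1 : Matrix (Fin d) (Fin d) ℂ)
      = quadraticMajorana Γ f * (quadraticMajorana Γ f * quadraticMajorana Γ e) *
          quadraticMajorana Γ e := by
        rw [← Matrix.mul_assoc, hf, Matrix.one_mul, he]
    _ = 0 := by rw [h, Matrix.mul_zero, Matrix.zero_mul]

/-- Each step doubles the space: `diag(1, -1)` anti-commutes with every off-diagonal block matrix. A
general index type lets the doubled space be `ι ⊕ ι`. -/
theorem exists_anticommuting_involutions (n : ℕ) :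
    ∃ (ι : Type) (_ : Fintype ι) (_ : DecidableEq ι) (_ : Nonempty ι) (Γ : Fin n → Matrix ι ι ℂ),
      (∀ j, (Γ j).IsHermitian) ∧ (∀ j, Γ j * Γ j = 1) ∧
        ∀ j k, j ≠ k → Γ j * Γ k + Γ k * Γ j = 0 := by
  induction n with
  | zero => exact ⟨Unit, inferInstance, inferInstance, inferInstance, 0, nofun, nofun, nofun⟩
  | succ n ih =>
    obtain ⟨ι, _, _, _, Γ, h1, h2, h3⟩ := ih
    refine ⟨ι ⊕ ι, inferInstance, inferInstance, inferInstance,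
      Fin.cons (Matrix.fromBlocks 1 0 0 (-1)) fun j => Matrix.fromBlocks 0 (Γ j) (Γ j) 0, ?_, ?_, ?_⟩
    · refine Fin.cases ?_ fun j => ?_
      · simp [Matrix.IsHermitian, Matrix.fromBlocks_conjTranspose]
      · simp [Matrix.IsHermitian, Matrix.fromBlocks_conjTranspose, (h1 j).eq]
    · refine Fin.cases ?_ fun j => ?_
      · simp [Matrix.fromBlocks_multiply]
      · simp [Matrix.fromBlocks_multiply, h2]
    · refine Fin.cases (Fin.cases ?_ fun k => ?_) fun j => Fin.cases ?_ fun k => ?_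
      · simp
      · simp [Matrix.fromBlocks_multiply, Matrix.fromBlocks_add]
      · simp [Matrix.fromBlocks_multiply, Matrix.fromBlocks_add]
      · intro hjk
        have := h3 j k fun h => hjk (by rw [h])
        simp [Matrix.fromBlocks_multiply, Matrix.fromBlocks_add, this]

theorem exists_isMajoranaFamily (n : ℕ) :
    ∃ d : ℕ, 0 < d ∧ ∃ Γ : Fin n → Matrix (Fin d) (Fin d) ℂ, IsMajoranaFamily Γ := by
  obtain ⟨ι, _, _, _, Γ, h1, h2, h3⟩ := exists_anticommuting_involutions n
  let φ := Matrix.reindexAlgEquiv ℂ ℂ (Fintype.equivFin ι)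
  refine ⟨Fintype.card ι, Fintype.card_pos, fun j => φ (Γ j), fun j => ?_, fun j => ?_,
    fun j k hjk => ?_⟩
  · exact (h1 j).submatrix _
  · rw [← map_mul, h2, map_one]
  · rw [← map_mul, ← map_mul, ← map_add, h3 j k hjk, map_zero]

end Majorana

/-! ### From an extremal Majorana state to a skew-conference matrix -/

section SkewConference

variable {n d : ℕ}

/-- The matrix whose columns are the vectors `Γ j ψ`. -/
def orbitMatrix (Γ : Fin n → Matrix (Fin d) (Fin d) ℂ) (ψ : Fin d → ℂ) :
    Matrix (Fin d) (Fin n) ℂ :=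
  Matrix.of fun i j => (Γ j *ᵥ ψ) i

theorem conjTranspose_orbitMatrix_mul_apply {Γ Δ : Fin n → Matrix (Fin d) (Fin d) ℂ}
    (hΓ : ∀ j, (Γ j).IsHermitian) (ψ : Fin d → ℂ) (j k : Fin n) :
    ((orbitMatrix Γ ψ)ᴴ * orbitMatrix Δ ψ) j k = star ψ ⬝ᵥ ((Γ j * Δ k) *ᵥ ψ) := by
  have h : ((orbitMatrix Γ ψ)ᴴ * orbitMatrix Δ ψ) j k = star (Γ j *ᵥ ψ) ⬝ᵥ (Δ k *ᵥ ψ) := rfl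
  rw [h, Matrix.star_mulVec, (hΓ j).eq, ← Matrix.dotProduct_mulVec, Matrix.mulVec_mulVec]

theorem sum_sq_skew {C : Matrix (Fin n) (Fin n) ℝ} (h0 : ∀ i, C i i = 0)
    (h1 : ∀ i j, i ≠ j → C i j = 1 ∨ C i j = -1) (i : Fin n) :
    ∑ j, C i j * C i j = (n : ℝ) - 1 := by
  rw [← Finset.add_sum_erase _ _ (Finset.mem_univ i), h0,
    Finset.sum_congr rfl (g := fun _ => (1 : ℝ)) fun j hj => by
      rcases h1 i j (Finset.ne_of_mem_erase hj).symm with h | h <;> rw [h] <;> norm_num]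
  have := i.pos
  rw [Finset.sum_const, Finset.card_erase_of_mem (Finset.mem_univ i), Finset.card_univ,
    Fintype.card_fin, nsmul_eq_mul, Nat.cast_sub this]
  simp

/-- A state of Majorana operators whose covariances are all `± 1 / √(n - 1)` has a skew-conference
matrix as rescaled covariance matrix. -/
theorem exists_skewConference_of_state (hn : 2 ≤ n) {Γ : Fin n → Matrix (Fin d) (Fin d) ℂ}
    (hΓ : IsMajoranaFamily Γ) {ψ : Fin d → ℂ} (hψ : star ψ ⬝ᵥ ψ = 1)
    {a : {s : Finset (Fin n) // s.card = 2} → ℤˣ}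
    (ha : ∀ e, star ψ ⬝ᵥ (quadraticMajorana Γ e *ᵥ ψ) =
      ((a e : ℤ) : ℂ) * ((1 / √((n - 1 : ℕ) : ℝ) : ℝ) : ℂ)) :
    ∃ C : Matrix (Fin n) (Fin n) ℝ, IsSkewConferenceMatrix C := by
  set l : ℝ := √((n - 1 : ℕ) : ℝ) with hl
  have hn1 : ((n - 1 : ℕ) : ℝ) = (n : ℝ) - 1 := by rw [Nat.cast_sub (by omega)]; simp
  have hpos : (0 : ℝ) < (n : ℝ) - 1 := by
    have : (2 : ℝ) ≤ n := by exact_mod_cast hn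
    linarith
  have hl0 : 0 < l := Real.sqrt_pos.mpr (hn1 ▸ hpos)
  have hll : l * l = (n : ℝ) - 1 := by rw [hl, Real.mul_self_sqrt (hn1 ▸ hpos.le), hn1]
  -- The signs `a` orient the edges: `a` above the diagonal, `-a` below it.
  let C : Matrix (Fin n) (Fin n) ℝ := Matrix.of fun u v =>
    if h : u = v then 0 else if u < v then ((a (pairEdge u v h) : ℤ) : ℝ)
      else -((a (pairEdge u v h) : ℤ) : ℝ)
  have hCd : ∀ u, C u u = 0 := fun u => by simp [C]
  have hClt : ∀ u v (h : u < v), C u v = ((a (pairEdge u v h.ne) : ℤ) : ℝ) := fun u v h => by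
    simp [C, h, h.ne]
  have hCskew : ∀ u v, C v u = -C u v := by
    have key : ∀ u v, u < v → C v u = -C u v := by
      intro u v h
      have he : pairEdge v u h.ne' = pairEdge u v h.ne := Subtype.ext (Finset.pair_comm v u)
      rw [hClt u v h, ← he]
      simp [C, h.ne', h.not_gt]
    intro u v
    rcases lt_trichotomy u v with h | rfl | h
    · exact key u v h
    · simp [hCd]
    · rw [key v u h, neg_neg]
  have hCpm : ∀ u v, u ≠ v → C u v = 1 ∨ C u v = -1 := by
    have key : ∀ u v, u < v → C u v = 1 ∨ C u v = -1 := by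
      intro u v h
      rw [hClt u v h]
      rcases Int.units_eq_one_or (a (pairEdge u v h.ne)) with h | h <;> simp [h]
    intro u v h
    rcases lt_or_gt_of_ne h with h | h
    · exact key u v h
    · rw [hCskew v u]
      rcases key v u h with h | h <;> simp [h]
  set c : Matrix (Fin n) (Fin n) ℂ := C.map Complex.ofReal with hc
  set Φ := orbitMatrix Γ ψ
  have hK : Φᴴ * Φ = 1 - (Complex.I * ((1 / l : ℝ) : ℂ)) • c := by
    have key : ∀ u v, u < v →
        star ψ ⬝ᵥ ((Γ u * Γ v) *ᵥ ψ) = -(Complex.I * ((1 / l : ℝ) : ℂ) * (C u v : ℂ)) := by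
      intro u v h
      have h1 := ha (pairEdge u v h.ne)
      rw [quadraticMajorana_eq h rfl, Matrix.smul_mulVec, dotProduct_smul, smul_eq_mul] at h1
      rw [hClt u v h]
      have h2 := congrArg (fun z => -Complex.I * z) h1
      simp only [← mul_assoc, neg_mul, Complex.I_mul_I, neg_neg, one_mul] at h2
      rw [h2]
      push_cast
      ring
    ext u v
    rw [conjTranspose_orbitMatrix_mul_apply hΓ.1]
    simp only [Matrix.sub_apply, Matrix.smul_apply, smul_eq_mul, hc, Matrix.map_apply]
    rcases lt_trichotomy u v with h | rfl | h
    · rw [key u v h, Matrix.one_apply_ne h.ne, zero_sub]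
    · simp [hΓ.2.1, hCd, hψ]
    · rw [hΓ.anticommute h.ne', Matrix.neg_mulVec, dotProduct_neg, key v u h,
        Matrix.one_apply_ne h.ne', hCskew v u]
      push_cast
      ring
  have hcT : cᵀ = -c := by
    ext u v
    simp [hc, hCskew u v]
  have hPS : (Φᴴ * Φ).PosSemidef := Matrix.posSemidef_conjTranspose_mul_self Φ
  have hprod : (Φᴴ * Φ)ᵀ * (Φᴴ * Φ) = 1 + ((1 / (l * l) : ℝ) : ℂ) • (c * c) := by
    rw [hK, Matrix.transpose_sub, Matrix.transpose_smul, hcT, Matrix.transpose_one]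
    simp only [mul_sub, smul_neg, sub_neg_eq_add, add_mul, one_mul, mul_one,
      smul_mul_smul_comm]
    have : Complex.I * ((1 / l : ℝ) : ℂ) * (Complex.I * ((1 / l : ℝ) : ℂ)) =
        -((1 / (l * l) : ℝ) : ℂ) := by
      push_cast
      linear_combination (1 / (l : ℂ)) ^ 2 * Complex.I_mul_I
    rw [this]
    module
  -- `C` is skew with `n - 1` unit entries per row, so `tr (C²) = -n (n - 1)`, which cancels `tr 1 =
  -- n` after division by `l² = n - 1`.
  have htr : ((Φᴴ * Φ)ᵀ * (Φᴴ * Φ)).trace = 0 := by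
    have hcc : (c * c).trace = ((-(n * ((n : ℝ) - 1)) : ℝ) : ℂ) := by
      have h1 : (C * C).trace = -(n * ((n : ℝ) - 1)) := by
        have h2 : ∀ i, (C * C) i i = -((n : ℝ) - 1) := fun i => by
          rw [← sum_sq_skew hCd hCpm i, Matrix.mul_apply, ← Finset.sum_neg_distrib]
          exact Finset.sum_congr rfl fun j _ => by rw [hCskew i j]; ring
        simp [Matrix.trace, h2]
        ring
      have h3 : c * c = (C * C).map Complex.ofReal :=
        (Matrix.map_mul (f := Complex.ofRealHom)).symm
      rw [h3, ← h1]
      simp [Matrix.trace]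
    rw [hprod, Matrix.trace_add, Matrix.trace_one, Matrix.trace_smul, hcc, smul_eq_mul, hll,
      ← Complex.ofReal_mul, Fintype.card_fin, ← Complex.ofReal_natCast, ← Complex.ofReal_add]
    rw [Complex.ofReal_eq_zero]
    field_simp
    ring
  -- Both factors are positive semidefinite: writing `K = Φᴴ Φ`, the zero trace is that of `Φ Kᵀ
  -- Φᴴ`, so `Kᵀ Φᴴ = 0`.
  have hzero : (Φᴴ * Φ)ᵀ * (Φᴴ * Φ) = 0 := by
    have h1 : (Φᴴᴴ * (Φᴴ * Φ)ᵀ * Φᴴ).trace = 0 := by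
      rw [← htr, Matrix.conjTranspose_conjTranspose, Matrix.mul_assoc, Matrix.trace_mul_comm,
        Matrix.mul_assoc]
    rw [(hPS.transpose.conjTranspose_mul_mul_same Φᴴ).trace_eq_zero_iff] at h1
    rw [← Matrix.mul_assoc, hPS.transpose.mul_eq_zero_of_conj_eq_zero h1, Matrix.zero_mul]
  rw [hprod] at hzero
  have hCC : C * C = -(((n : ℝ) - 1) • (1 : Matrix (Fin n) (Fin n) ℝ)) := by
    have h3 : c * c = (C * C).map Complex.ofReal :=
      (Matrix.map_mul (f := Complex.ofRealHom)).symm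
    rw [h3] at hzero
    ext i j
    have h4 := congrFun (congrFun hzero i) j
    simp only [Matrix.add_apply, Matrix.smul_apply, Matrix.map_apply, smul_eq_mul,
      Matrix.zero_apply, Matrix.neg_apply] at h4 ⊢
    have h5 : (1 : Matrix (Fin n) (Fin n) ℝ) i j + 1 / (l * l) * (C * C) i j = 0 := by
      have : ((1 : Matrix (Fin n) (Fin n) ℂ) i j) = (((1 : Matrix (Fin n) (Fin n) ℝ) i j : ℝ) : ℂ) := by
        simp only [Matrix.one_apply]
        split_ifs <;> simp
      rw [this] at h4
      exact_mod_cast h4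
    rw [hll] at h5
    field_simp at h5
    linarith
  have hCT : Cᵀ = -C := by
    ext u v
    simp [hCskew u v]
  exact ⟨C, hCd, hCpm, by rw [hCT, mul_neg, hCC, neg_neg], hCT⟩

end SkewConference

/-! ### From a skew-conference matrix to an extremal Majorana state -/

section Vacuum

variable {n : ℕ}

/-- Fermionic modes with a vacuum vector: self-adjoint operators `x j`, `y j` satisfying the
canonical anti-commutation relations and a unit vector annihilated by all `x j + i y j`. -/
theorem exists_modes_with_vacuum (n : ℕ) :
    ∃ d : ℕ, 0 < d ∧ ∃ (x y : Fin n → Matrix (Fin d) (Fin d) ℂ) (ψ : Fin d → ℂ),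
      (∀ j, (x j).IsHermitian) ∧ (∀ j, (y j).IsHermitian) ∧
      (∀ j k, x j * x k + x k * x j = if j = k then 2 else 0) ∧
      (∀ j k, y j * y k + y k * y j = if j = k then 2 else 0) ∧
      (∀ j k, x j * y k + y k * x j = 0) ∧
      star ψ ⬝ᵥ ψ = 1 ∧ ∀ j, y j *ᵥ ψ = Complex.I • (x j *ᵥ ψ) := by
  obtain ⟨d, hd, Γ, hΓ⟩ := exists_isMajoranaFamily (n + n)
  set x : Fin n → Matrix (Fin d) (Fin d) ℂ := fun j => Γ (Fin.castAdd n j) with hx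
  set z : Fin n → Matrix (Fin d) (Fin d) ℂ := fun j => Γ (Fin.natAdd n j) with hz
  have hne : ∀ j k : Fin n, Fin.castAdd n j ≠ Fin.natAdd n k := fun j k h => by
    have := congrArg Fin.val h
    simp at this
    omega
  have hanti : ∀ {u v : Fin (n + n)}, u ≠ v → Γ u * Γ v = -(Γ v * Γ u) := hΓ.anticommute
  have hxx : ∀ j k, x j * x k + x k * x j = if j = k then 2 else 0 := by
    intro j k
    split_ifs with h
    · subst h
      rw [hΓ.2.1, one_add_one_eq_two]
    · exact hΓ.2.2 _ _ fun h' => h (Fin.castAdd_injective n n h')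
  have hzz : ∀ j k, z j * z k + z k * z j = if j = k then 2 else 0 := by
    intro j k
    split_ifs with h
    · subst h
      rw [hΓ.2.1, one_add_one_eq_two]
    · exact hΓ.2.2 _ _ fun h' => h (Fin.natAdd_injective n n h')
  -- The parities `i x j z j` commute; a column of a nonzero joint projection is a common
  -- eigenvector.
  obtain ⟨P, -, hP1, hPB⟩ := exists_joint_projections (fun j => Complex.I • (x j * z j))
    (fun j => isHermitian_I_smul_mul (hΓ.1 _) (hΓ.1 _) (hanti (hne j j)))
    (fun j => I_smul_mul_mul_self (hΓ.2.1 _) (hΓ.2.1 _) (hanti (hne j j)))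
    (fun j k => by
      rcases eq_or_ne j k with rfl | hjk
      · rfl
      rw [smul_mul_smul_comm, smul_mul_smul_comm]
      congr 1
      have h1 : x j * x k = -(x k * x j) :=
        hanti fun h => hjk (Fin.castAdd_injective n n h)
      have h2 : z j * z k = -(z k * z j) :=
        hanti fun h => hjk (Fin.natAdd_injective n n h)
      exact (commute_mul_of_anticommute h1 (hanti (hne k j).symm)).mul_right
        (commute_mul_of_anticommute (hanti (hne j k)) h2))
  have : Nonempty (Fin d) := ⟨⟨0, hd⟩⟩
  obtain ⟨a, ha⟩ : ∃ a, P a ≠ 0 := by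
    by_contra! h
    simp [h] at hP1
  obtain ⟨i, hi⟩ : ∃ i, (P a)ᵀ i ≠ 0 := by
    by_contra! h
    exact ha (Matrix.transpose_injective (Matrix.ext fun i j => congrFun (h i) j))
  obtain ⟨r, hr⟩ := exists_unit_vector_of_ne_zero hi
  set ψ := r • (P a)ᵀ i with hψ
  have heig : ∀ j, (Complex.I • (x j * z j)) *ᵥ ψ = ((a j : ℤ) : ℂ) • ψ := by
    intro j
    rw [hψ, Matrix.mulVec_smul, smul_comm _ r]
    congr 1
    ext k
    exact congrFun (congrFun (hPB a j) k) i
  -- Replacing `z j` by `y j = -(a j) z j` absorbs the parity eigenvalue, so that `y j ψ = i x j ψ`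
  -- for every `j`.
  refine ⟨d, hd, x, fun j => (-((a j : ℤ) : ℂ)) • z j, ψ, fun j => hΓ.1 _, fun j => ?_, hxx,
    fun j k => ?_, fun j k => ?_, hr, fun j => ?_⟩
  · rw [Matrix.IsHermitian, Matrix.conjTranspose_smul, (hΓ.1 _).eq, star_neg, star_unit_coe]
  · rw [smul_mul_smul_comm, smul_mul_smul_comm, mul_comm (-((a k : ℤ) : ℂ)), ← smul_add, hzz]
    split_ifs with h
    · subst h
      rw [neg_mul_neg, unit_coe_mul_self, one_smul]
    · rw [smul_zero]
  · rw [mul_smul_comm, smul_mul_assoc, ← smul_add, hΓ.2.2 _ _ (hne j k), smul_zero]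
  · have h1 : z j *ᵥ ψ = (-Complex.I * ((a j : ℤ) : ℂ)) • (x j *ᵥ ψ) := by
      have h2 := congrArg (fun w => -Complex.I • (x j *ᵥ w)) (heig j)
      simp only [Matrix.mulVec_mulVec, Matrix.mulVec_smul, Matrix.smul_mulVec,
        smul_smul, ← Matrix.mul_assoc] at h2
      rw [show x j * x j = 1 from hΓ.2.1 _, Matrix.one_mul] at h2
      simpa using h2
    rw [Matrix.smul_mulVec, h1, smul_smul]
    congr 1
    linear_combination Complex.I * unit_coe_mul_self (a j)

/-- A skew-conference matrix is, up to rescaling, the covariance matrix of a state of Majorana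
operators. -/
theorem exists_state_of_skewConference (hn : 2 ≤ n) {C : Matrix (Fin n) (Fin n) ℝ}
    (hC : IsSkewConferenceMatrix C) :
    ∃ d : ℕ, 0 < d ∧ ∃ (Γ : Fin n → Matrix (Fin d) (Fin d) ℂ) (ψ : Fin d → ℂ)
      (a : {s : Finset (Fin n) // s.card = 2} → ℤˣ), IsMajoranaFamily Γ ∧ star ψ ⬝ᵥ ψ = 1 ∧
      ∀ e, star ψ ⬝ᵥ (quadraticMajorana Γ e *ᵥ ψ) =
        ((a e : ℤ) : ℂ) * ((1 / √((n - 1 : ℕ) : ℝ) : ℝ) : ℂ) := by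
  obtain ⟨d, hd, x, y, ψ, hxH, hyH, hxx, hyy, hxy, hψ, hvac⟩ := exists_modes_with_vacuum n
  obtain ⟨hC0, hC1, hCC, hCT⟩ := hC
  set l : ℝ := √((n - 1 : ℕ) : ℝ) with hl
  have hn1 : ((n - 1 : ℕ) : ℝ) = (n : ℝ) - 1 := by rw [Nat.cast_sub (by omega)]; simp
  have hpos : (0 : ℝ) < (n : ℝ) - 1 := by
    have : (2 : ℝ) ≤ n := by exact_mod_cast hn
    linarith
  have hl0 : 0 < l := Real.sqrt_pos.mpr (hn1 ▸ hpos)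
  have hll : l * l = (n : ℝ) - 1 := by rw [hl, Real.mul_self_sqrt (hn1 ▸ hpos.le), hn1]
  set J : Matrix (Fin n) (Fin n) ℂ := ((1 / l) • C).map Complex.ofReal with hJ
  have hJT : Jᵀ = -J := by
    rw [hJ, ← Matrix.transpose_map, Matrix.transpose_smul, hCT]
    ext i j
    simp
  have hJH : Jᴴ = -J := by
    rw [← hJT]
    ext i j
    simp [hJ]
  have hJJ : J * Jᵀ = 1 := by
    have h1 : ((1 / l) • C) * ((1 / l) • C)ᵀ = 1 := by
      rw [Matrix.transpose_smul, smul_mul_smul_comm, hCC, smul_smul, ← hll]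
      rw [show 1 / l * (1 / l) * (l * l) = 1 by field_simp, one_smul]
    rw [hJ, ← Matrix.transpose_map]
    have h2 := Matrix.map_mul (f := Complex.ofRealHom) (L := (1 / l) • C) (M := ((1 / l) • C)ᵀ)
    rw [h1] at h2
    refine Eq.trans h2.symm ?_
    ext i j
    simp [Matrix.one_apply]
  have hJ2 : J * J = -1 := by
    rw [hJT, mul_neg] at hJJ
    rw [← hJJ, neg_neg]
  have hJTJ : Jᵀ * J = 1 := by rw [hJT, neg_mul, hJ2, neg_neg]
  -- `q = 1 / √2` normalises `x u + z u`, a sum of two anti-commuting involutions.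
  obtain ⟨q, hq, hqs⟩ : ∃ q : ℂ, q * q = 1 / 2 ∧ star q = q := by
    refine ⟨((√(1 / 2) : ℝ) : ℂ), ?_, by simp⟩
    rw [← Complex.ofReal_mul, Real.mul_self_sqrt (by norm_num)]
    norm_num
  set z : Fin n → Matrix (Fin d) (Fin d) ℂ := fun u => ∑ j, J j u • y j with hz
  have hxz : ∀ u w, x u * z w + z w * x u = 0 := by
    intro u w
    simp only [hz, Finset.mul_sum, Finset.sum_mul, ← Finset.sum_add_distrib, mul_smul_comm,
      smul_mul_assoc, ← smul_add, hxy, smul_zero, Finset.sum_const_zero]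
  have hzz : ∀ u w, z u * z w + z w * z u = if u = w then 2 else 0 := by
    intro u w
    have h1 : z u * z w + z w * z u = ∑ j, ∑ k, (J j u * J k w) • (y j * y k + y k * y j) := by
      simp only [hz, Finset.sum_mul_sum, smul_mul_smul_comm, smul_add, Finset.sum_add_distrib]
      congr 1
      rw [Finset.sum_comm]
      exact Finset.sum_congr rfl fun j _ => Finset.sum_congr rfl fun k _ => by rw [mul_comm]
    rw [h1]
    simp only [hyy, smul_ite, smul_zero, Finset.sum_ite_eq, Finset.mem_univ, if_true,
      ← Finset.sum_smul]
    have h2 : ∑ j, J j u * J j w = (1 : Matrix (Fin n) (Fin n) ℂ) u w := by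
      rw [← hJTJ]
      rfl
    rw [h2, Matrix.one_apply]
    split_ifs <;> simp
  set Γ : Fin n → Matrix (Fin d) (Fin d) ℂ := fun u => q • (x u + z u) with hΓdef
  have hac : ∀ u w, Γ u * Γ w + Γ w * Γ u = if u = w then 2 else 0 := by
    intro u w
    have h1 : Γ u * Γ w + Γ w * Γ u = (q * q) • ((x u * x w + x w * x u) +
        (z u * z w + z w * z u) + (x u * z w + z w * x u) + (x w * z u + z u * x w)) := by
      simp only [hΓdef, smul_mul_smul_comm, mul_add, add_mul]
      module
    rw [h1, hxx, hzz, hxz, hxz, hq]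
    split_ifs
    · rw [add_zero, add_zero, ← two_smul ℂ, smul_smul]
      norm_num
    · simp
  have hΓ : IsMajoranaFamily Γ := by
    refine ⟨fun u => ?_, fun u => ?_, fun u w h => by rw [hac, if_neg h]⟩
    · rw [Matrix.IsHermitian, hΓdef, Matrix.conjTranspose_smul, Matrix.conjTranspose_add,
        (hxH u).eq, hqs, hz, Matrix.conjTranspose_sum]
      congr 2
      refine Finset.sum_congr rfl fun j _ => ?_
      rw [Matrix.conjTranspose_smul, (hyH j).eq]
      congr 1
      simp [hJ]
    · have h1 := hac u u
      rw [if_pos rfl, ← two_smul ℂ] at h1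
      have h2 : (2 : Matrix (Fin d) (Fin d) ℂ) = (2 : ℂ) • 1 := by
        rw [two_smul, one_add_one_eq_two]
      rw [h2] at h1
      exact smul_right_injective _ (two_ne_zero' ℂ) h1
  set X := orbitMatrix x ψ with hX
  -- The symmetric part is `1` by the relations of the `x j`; the antisymmetric part vanishes
  -- because `x j` and `y k` anti-commute while `y k` acts on `ψ` as `i x k`.
  have hXX : Xᴴ * X = 1 := by
    ext j k
    have h1 : ∀ j k, star ψ ⬝ᵥ ((x j * y k) *ᵥ ψ) = Complex.I * (Xᴴ * X) j k := by
      intro j k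
      rw [← Matrix.mulVec_mulVec, hvac, Matrix.mulVec_smul, dotProduct_smul, Matrix.mulVec_mulVec,
        conjTranspose_orbitMatrix_mul_apply hxH, smul_eq_mul]
    have h2 : star ψ ⬝ᵥ ((y k * x j) *ᵥ ψ) = -Complex.I * (Xᴴ * X) k j := by
      rw [conjTranspose_orbitMatrix_mul_apply hxH, ← Matrix.mulVec_mulVec, Matrix.dotProduct_mulVec,
        ← (hyH k).eq, ← Matrix.star_mulVec, hvac, star_smul, smul_dotProduct, Matrix.star_mulVec,
        (hxH k).eq, ← Matrix.dotProduct_mulVec, Matrix.mulVec_mulVec]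
      simp
    have h3 : Complex.I * (Xᴴ * X) j k + -Complex.I * (Xᴴ * X) k j = 0 := by
      rw [← h1, ← h2, ← dotProduct_add, ← Matrix.add_mulVec, hxy, Matrix.zero_mulVec,
        dotProduct_zero]
    have h4 : (Xᴴ * X) j k + (Xᴴ * X) k j = 2 * (1 : Matrix (Fin n) (Fin n) ℂ) j k := by
      rw [conjTranspose_orbitMatrix_mul_apply hxH, conjTranspose_orbitMatrix_mul_apply hxH,
        ← dotProduct_add, ← Matrix.add_mulVec, hxx, Matrix.one_apply]
      split_ifs
      · have h5 : (2 : Matrix (Fin d) (Fin d) ℂ) = (2 : ℂ) • 1 := by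
          rw [two_smul, one_add_one_eq_two]
        rw [h5, Matrix.smul_mulVec, Matrix.one_mulVec, dotProduct_smul, hψ, smul_eq_mul]
      · simp
    linear_combination (1 / 2 : ℂ) * h4 - (1 / 2 : ℂ) * Complex.I * h3 +
      (1 / 2 : ℂ) * ((Xᴴ * X) j k - (Xᴴ * X) k j) * Complex.I_mul_I
  have hG : orbitMatrix Γ ψ = X * (q • (1 + Complex.I • J)) := by
    ext i u
    have h1 : Γ u *ᵥ ψ = q • (x u *ᵥ ψ + ∑ j, J j u • (Complex.I • (x j *ᵥ ψ))) := by
      simp only [hΓdef, hz, Matrix.smul_mulVec, Matrix.add_mulVec, Matrix.sum_mulVec, hvac]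
    rw [Matrix.mul_smul, Matrix.mul_add, Matrix.mul_one, Matrix.mul_smul, Matrix.smul_apply, Matrix.add_apply,
      Matrix.smul_apply, Matrix.mul_apply]
    change (Γ u *ᵥ ψ) i = q • ((x u *ᵥ ψ) i + Complex.I • ∑ j, (x j *ᵥ ψ) i * J j u)
    rw [h1, Pi.smul_apply, Pi.add_apply, Finset.sum_apply, Finset.smul_sum]
    congr 2
    refine Finset.sum_congr rfl fun j _ => ?_
    simp only [Pi.smul_apply, smul_eq_mul]
    ring
  -- As `J² = -1`, the Hermitian matrix `1 + i J` squares to twice itself, and `q² = 1 / 2` removes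
  -- the factor.
  have hK : (orbitMatrix Γ ψ)ᴴ * orbitMatrix Γ ψ = 1 + Complex.I • J := by
    have h1 : (q • (1 + Complex.I • J))ᴴ = q • (1 + Complex.I • J) := by
      rw [Matrix.conjTranspose_smul, Matrix.conjTranspose_add, Matrix.conjTranspose_smul, hJH, hqs]
      simp
    rw [hG, Matrix.conjTranspose_mul, h1, Matrix.mul_assoc, ← Matrix.mul_assoc Xᴴ, hXX,
      Matrix.one_mul, smul_mul_smul_comm, hq]
    simp only [mul_add, add_mul, one_mul, mul_one, smul_mul_smul_comm, Complex.I_mul_I, hJ2]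
    module
  have hcov : ∀ u v, u < v →
      star ψ ⬝ᵥ ((Complex.I • (Γ u * Γ v)) *ᵥ ψ) = ((-C u v : ℝ) : ℂ) * ((1 / l : ℝ) : ℂ) := by
    intro u v h
    rw [Matrix.smul_mulVec, dotProduct_smul, ← conjTranspose_orbitMatrix_mul_apply hΓ.1, hK,
      Matrix.add_apply, Matrix.one_apply_ne h.ne, Matrix.smul_apply, smul_eq_mul, smul_eq_mul,
      zero_add, ← mul_assoc, Complex.I_mul_I, hJ]
    simp
    ring
  have hsign : ∀ e : {s : Finset (Fin n) // s.card = 2}, ∃ s : ℤˣ,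
      star ψ ⬝ᵥ (quadraticMajorana Γ e *ᵥ ψ) = ((s : ℤ) : ℂ) * ((1 / l : ℝ) : ℂ) := by
    intro e
    obtain ⟨u, v, huv, he⟩ := exists_lt_eq_pair e
    rw [quadraticMajorana_eq huv he, hcov u v huv]
    rcases hC1 u v huv.ne with h | h
    · exact ⟨-1, by simp [h]⟩
    · exact ⟨1, by simp [h]⟩
  choose a ha using hsign
  exact ⟨d, hd, Γ, ψ, a, hΓ, hψ, ha⟩

end Vacuum

/-! ### The robustness of families with anti-commutativity graph `J(n, 2)` -/

section Robustness

variable {n d : ℕ} {A : {s : Finset (Fin n) // s.card = 2} → Matrix (Fin d) (Fin d) ℂ}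

theorem trace_eq_zero_of_johnsonGraph (hn : 3 ≤ n) (hA : IsBinaryObservableFamily A)
    (hG : IsAnticommutativityGraph (johnsonGraph n 2) A)
    (e : {s : Finset (Fin n) // s.card = 2}) : (A e).trace = 0 := by
  obtain ⟨u, v, huv, he⟩ := exists_lt_eq_pair e
  obtain ⟨w, hw⟩ : ∃ w, w ∉ e.1 := by
    by_contra! h
    have h1 := Finset.card_le_card (fun x _ => h x : (Finset.univ : Finset (Fin n)) ⊆ e.1)
    rw [e.2, Finset.card_univ, Fintype.card_fin] at h1
    omega
  have hu : u ∈ e.1 := by simp [he]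
  have huw : u ≠ w := fun h => hw (h ▸ hu)
  have hadj : (johnsonGraph n 2).Adj e (pairEdge u w huw) :=
    johnsonGraph_adj_of_mem hu (by simp [pairEdge]) fun h => hw (by rw [h]; simp [pairEdge])
  exact trace_eq_zero_of_anticommute (hA (pairEdge u w huw)).2 ((hG.1 _ _).mp hadj)

/-- For `n ≥ 3` every observable has an anti-commuting partner and so is traceless. For `n = 2` the
single observable may have nonzero trace, and the noise term drops out only at `η = 1`. -/
theorem mem_jointMeasurabilitySet_iff (hA : IsBinaryObservableFamily A)
    (hG : IsAnticommutativityGraph (johnsonGraph n 2) A) {η : ℝ} (h : 3 ≤ n ∨ η = 1) :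
    η ∈ jointMeasurabilitySet A ↔ η ∈ Set.Icc (0 : ℝ) 1 ∧
      ∃ E : ({s : Finset (Fin n) // s.card = 2} → ℤˣ) → Matrix (Fin d) (Fin d) ℂ, IsPOVM E ∧
        ∀ e, ∑ a, ((a e : ℤ) : ℂ) • E a = (η : ℂ) • A e := by
  have hnoisy : ∀ e, noisyObservable η (A e) = (η : ℂ) • A e := by
    intro e
    rcases h with h | rfl
    · exact noisyObservable_of_trace_eq_zero (trace_eq_zero_of_johnsonGraph h hA hG e) η
    · rw [noisyObservable_one, Complex.ofReal_one, one_smul]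
  rw [jointMeasurabilitySet, Set.mem_ofPred_eq, jointlyMeasurable_binaryEffect_iff]
  simp only [hnoisy]

theorem IsAnticommutativityGraph.commute_or_anticommute {V : Type*} {G : SimpleGraph V} {d d' : ℕ}
    {A : V → Matrix (Fin d) (Fin d) ℂ} {A' : V → Matrix (Fin d') (Fin d') ℂ}
    (hA : IsAnticommutativityGraph G A) (hA' : IsAnticommutativityGraph G A') (v w : V) :
    (A v * A w = A w * A v ∧ A' v * A' w = A' w * A' v) ∨
      (A v * A w = -(A w * A v) ∧ A' v * A' w = -(A' w * A' v)) := by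
  by_cases h : G.Adj v w
  · exact Or.inr ⟨(hA.1 v w).mp h, (hA'.1 v w).mp h⟩
  · exact Or.inl ⟨hA.2 v w h, hA'.2 v w h⟩

theorem mem_jointMeasurabilitySet_of_skewConference (hn : 2 ≤ n)
    (hA : IsBinaryObservableFamily A) (hG : IsAnticommutativityGraph (johnsonGraph n 2) A)
    {C : Matrix (Fin n) (Fin n) ℝ} (hC : IsSkewConferenceMatrix C) :
    1 / √((n - 1 : ℕ) : ℝ) ∈ jointMeasurabilitySet A := by
  obtain ⟨d', hd', Γ, ψ, a, hΓ, hψ, ha⟩ := exists_state_of_skewConference hn hC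
  have hq := hΓ.isBinaryObservableFamily
  obtain ⟨E, hE, hm⟩ := exists_povm_of_state A (quadraticMajorana Γ) (fun e => (hA e).1)
    (fun e => (hA e).2) (fun e => (hq e).1) (fun e => (hq e).2)
    (hG.commute_or_anticommute (hΓ.isAnticommutativityGraph hd')) ψ hψ a _ ha
  refine (mem_jointMeasurabilitySet_iff hA hG ?_).mpr ⟨⟨by positivity, ?_⟩, E, hE, hm⟩
  · rcases hn.eq_or_lt with rfl | h
    · right
      norm_num
    · exact Or.inl h
  · have h1 : (1 : ℝ) ≤ ((n - 1 : ℕ) : ℝ) := Nat.one_le_cast.mpr (by omega)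
    exact (div_le_one (Real.sqrt_pos.mpr (by linarith))).mpr (Real.one_le_sqrt.mpr h1)

theorem isSkewConferenceMatrix_two :
    IsSkewConferenceMatrix (!![0, 1; -1, 0] : Matrix (Fin 2) (Fin 2) ℝ) := by
  refine ⟨fun i => ?_, fun i j h => ?_, ?_, ?_⟩
  · fin_cases i <;> rfl
  · fin_cases i <;> fin_cases j <;> simp at h ⊢
  · ext i j
    fin_cases i <;> fin_cases j <;> simp [Matrix.mul_apply] <;> norm_num
  · ext i j
    fin_cases i <;> fin_cases j <;> simp

/-- Extremality travels from `A` to the Majorana observables: tight parent for `A`, state for `A`,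
parent for the quadratic Majorana observables by dilation, and finally a Majorana state. -/
theorem exists_skewConference_of_mem (hn : 3 ≤ n) (hd : 0 < d)
    (hA : IsBinaryObservableFamily A) (hG : IsAnticommutativityGraph (johnsonGraph n 2) A)
    (h : 1 / √((n - 1 : ℕ) : ℝ) ∈ jointMeasurabilitySet A) :
    ∃ C : Matrix (Fin n) (Fin n) ℝ, IsSkewConferenceMatrix C := by
  have : Nonempty (Fin d) := ⟨⟨0, hd⟩⟩
  obtain ⟨-, E, hE, hm⟩ := (mem_jointMeasurabilitySet_iff hA hG (Or.inl hn)).mp h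
  obtain ⟨φ, b, hφ, hb⟩ := exists_state_of_tight (fun e => (hA e).1) (fun e => (hA e).2) hE.1 hE.2
    hm (exists_star_clique fun e f => (hG.1 e f).mp)
  obtain ⟨d', hd', Γ, hΓ⟩ := exists_isMajoranaFamily n
  have : Nonempty (Fin d') := ⟨⟨0, hd'⟩⟩
  have hq := hΓ.isBinaryObservableFamily
  have hqG := hΓ.isAnticommutativityGraph hd'
  obtain ⟨E', hE', hm'⟩ := exists_povm_of_state (quadraticMajorana Γ) A (fun e => (hq e).1)
    (fun e => (hq e).2) (fun e => (hA e).1) (fun e => (hA e).2)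
    (hqG.commute_or_anticommute hG) φ hφ b _ hb
  obtain ⟨ψ, a, hψ, ha⟩ := exists_state_of_tight (fun e => (hq e).1) (fun e => (hq e).2) hE'.1 hE'.2
    hm' (exists_star_clique fun e f => (hqG.1 e f).mp)
  exact exists_skewConference_of_state (by omega) hΓ hψ ha

theorem le_of_mem_jointMeasurabilitySet (hn : 2 ≤ n) (hd : 0 < d)
    (hA : IsBinaryObservableFamily A) (hG : IsAnticommutativityGraph (johnsonGraph n 2) A)
    {η : ℝ} (h : η ∈ jointMeasurabilitySet A) : η ≤ 1 / √((n - 1 : ℕ) : ℝ) := by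
  rcases hn.eq_or_lt with rfl | hn
  · simpa using h.1.2
  have : Nonempty (Fin d) := ⟨⟨0, hd⟩⟩
  obtain ⟨-, E, hE, hm⟩ := (mem_jointMeasurabilitySet_iff hA hG (Or.inl hn)).mp h
  obtain ⟨K, hK, hKc, hKa⟩ := exists_star_clique (fun e f => (hG.1 e f).mp)
    (pairEdge (⟨0, by omega⟩ : Fin n) ⟨1, by omega⟩ (by simp))
  rw [← hKc]
  exact le_one_div_sqrt_card_of_clique (fun e => (hA e).1) (fun e => (hA e).2) hE.1 hE.2 hm
    ⟨_, hK⟩ hKa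

theorem jointMeasurabilitySet_nonempty (hn : 2 ≤ n)
    (hA : IsBinaryObservableFamily A) (hG : IsAnticommutativityGraph (johnsonGraph n 2) A) :
    (jointMeasurabilitySet A).Nonempty := by
  rcases hn.eq_or_lt with rfl | h
  -- For `n = 2` the trace may be nonzero; the order-two skew-conference matrix supplies the member
  -- `η = 1`.
  · exact ⟨_, mem_jointMeasurabilitySet_of_skewConference le_rfl hA hG isSkewConferenceMatrix_two⟩
  · exact ⟨0, zero_mem_jointMeasurabilitySet (trace_eq_zero_of_johnsonGraph h hA hG)⟩

end Robustness

theorem mainTheorem8 (n : ℕ) (hn : 2 ≤ n) :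
    (∃ d : ℕ, 0 < d ∧ ∃ Γ : Fin n → Matrix (Fin d) (Fin d) ℂ, IsMajoranaFamily Γ) ∧
    (∀ (d : ℕ) (_ : 0 < d) (Γ : Fin n → Matrix (Fin d) (Fin d) ℂ), IsMajoranaFamily Γ →
      IsBinaryObservableFamily (quadraticMajorana Γ) ∧
      IsAnticommutativityGraph (johnsonGraph n 2) (quadraticMajorana Γ)) ∧
    (∀ (d : ℕ) (_ : 0 < d)
      (A : {s : Finset (Fin n) // s.card = 2} → Matrix (Fin d) (Fin d) ℂ),
      IsBinaryObservableFamily A → IsAnticommutativityGraph (johnsonGraph n 2) A →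
      IsGreatest (jointMeasurabilitySet A) (incompatibilityRobustness A) ∧
      incompatibilityRobustness A ≤ 1 / √((n : ℝ) - 1) ∧
      (incompatibilityRobustness A = 1 / √((n : ℝ) - 1) ↔
        ∃ C : Matrix (Fin n) (Fin n) ℝ, IsSkewConferenceMatrix C)) := by
  refine ⟨exists_isMajoranaFamily n,
    fun d hd Γ hΓ => ⟨hΓ.isBinaryObservableFamily, hΓ.isAnticommutativityGraph hd⟩,
    fun d hd A hA hG => ?_⟩
  have hgr : IsGreatest (jointMeasurabilitySet A) (incompatibilityRobustness A) :=
    (isCompact_jointMeasurabilitySet A).isGreatest_sSup (jointMeasurabilitySet_nonempty hn hA hG)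
  have hn1 : (n : ℝ) - 1 = ((n - 1 : ℕ) : ℝ) := by
    rw [Nat.cast_sub (by omega), Nat.cast_one]
  rw [hn1]
  have hle := le_of_mem_jointMeasurabilitySet hn hd hA hG hgr.1
  refine ⟨hgr, hle, fun h => ?_, fun ⟨C, hC⟩ => ?_⟩
  · rcases hn.eq_or_lt with rfl | hn
    · exact ⟨_, isSkewConferenceMatrix_two⟩
    · exact exists_skewConference_of_mem hn hd hA hG (h ▸ hgr.1)
  · exact hle.antisymm (hgr.2 (mem_jointMeasurabilitySet_of_skewConference hn hA hG hC))
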